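/- **Theorem.** Let $d\ge 2$, let $\lambda>0$, and let $\mathbb V_0^{d+1}=\{(x,t)\in\mathbb R^d\times\mathbb R:\ \|x\|=t,\ 0\le t\le 1\}$ be the conic surface, with Lebesgue measure $\mathsf m$ given by $\int f\,d\mathsf m=\int_0^1 t^{d-1}\int_{\mathbb S^{d-1}}f(t\xi,t)\,d\sigma(\xi)\,dt$, where $\sigma$ is the surface measure of the unit sphere $\mathbb S^{d-1}$ and $\omega_d=\sigma(\mathbb S^{d-1})$. A polynomial on the cone is an element of $\mathbb R[x,t]/\langle t^2-\|x\|^2\rangle$; it has degree at most $n$ if it has a representative of total degree at most $n$. Every polynomial on the cone has a unique representative $P(x,t)$ that is harmonic in $x$, i.e. a sum of products $p(t)Y(x)$ with $Y$ a solid harmonic, and $\partial_t$ of it is defined as the class of $\partial P/\partial t$; thus $\partial_t\,[p(t)Y(x)]=p'(t)Y(x)$. Consider the inner products $$\langle f,g\rangle_{-1,-1}=\frac1{\omega_d}\int_{\mathbb V_0^{d+1}}\partial_t f\,\partial_t g\,d\mathsf m+\frac{\lambda}{\omega_d}\int_{\mathbb S^{d-1}}f(\xi,1)g(\xi,1)\,d\sigma(\xi),$$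 $$\langle f,g\rangle_{-1,1}=b\int_{\mathbb V_0^{d+1}}f\,g\,t^{-1}(1-t)\,d\mathsf m,$$ where $b>0$ is the constant with $\langle 1,1\rangle_{-1,1}=1$. For $\gamma\in\{-1,1\}$ and $n\ge0$, let $\mathcal V_n^d(\mathsf w_{-1,\gamma})$ be the space of polynomials on the cone of degree at most $n$ that are orthogonal, with respect to $\langle\cdot,\cdot\rangle_{-1,\gamma}$, to all polynomials of degree at most $n-1$; put $\mathcal V_{-1}^d(\mathsf w_{-1,1})=\{0\}$. Let $\mathcal H_n^{d,0}$ be the space of homogeneous harmonic polynomials of degree $n$ in $x$, regarded as polynomials on the cone. With $(x,t)=(t\xi,t)$, $\xi\in\mathbb S^{d-1}$, let $$\mathcal D_{\gamma}=t(1-t)\frac{d^2}{dt^2}+\bigl(d-1-(d+\gamma)t\bigr)\frac{d}{dt}+t^{-1}\Delta_0^{(\xi)},$$ where $d/dt$ is the derivative of $t\mapsto f(t\xi,t)$ for fixed $\xi$ and $\Delta_0^{(\xi)}$ is the Laplace–Beltrami operator of $\mathbb S^{d-1}$ acting in $\xi$. Then, for every $n=0,1,2,\ldots$, every $Z\in\mathcal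 V_n^d(\mathsf w_{-1,-1})$ satisfies $$\mathcal D_{-1}Z=-n(n+d-2)\,Z\qquad\text{on }\mathbb V_0^{d+1}\setminus\{(0,0)\},$$ and $\mathcal V_n^d(\mathsf w_{-1,-1})$ is the direct sum $$\mathcal V_n^d(\mathsf w_{-1,-1})=\mathcal H_n^{d,0}\oplus(1-t)\,\mathcal V_{n-1}^d(\mathsf w_{-1,1}).$$ -/

import Mathlib

noncomputable section

open MvPolynomial MeasureTheory

/-! ### Polynomials on the conic surface

The variables of `MvPolynomial (Fin (d + 1)) ℝ` are `x₁, …, x_d` (indices `i.castSucc`) and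
`t` (index `Fin.last d`). -/

/-- The quadratic polynomial `t² - ‖x‖²`. -/
def coneQuadric (d : ℕ) : MvPolynomial (Fin (d + 1)) ℝ :=
  X (Fin.last d) ^ 2 - ∑ i : Fin d, X i.castSucc ^ 2

/-- The ring `ℝ[x, t] / ⟨t² - ‖x‖²⟩` of polynomials on the conic surface. -/
abbrev ConePoly (d : ℕ) : Type :=
  MvPolynomial (Fin (d + 1)) ℝ ⧸ Ideal.span {coneQuadric d}

/-- The class of a polynomial in `(x, t)` modulo `t² - ‖x‖²`. -/
def coneMk (d : ℕ) : MvPolynomial (Fin (d + 1)) ℝ →ₐ[ℝ] ConePoly d :=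
  Ideal.Quotient.mkₐ ℝ _

/-- The coordinate `t` as a polynomial on the conic surface. -/
def coneT (d : ℕ) : ConePoly d := coneMk d (X (Fin.last d))

/-- The unit sphere of `ℝ^d`. -/
abbrev UnitSphere (d : ℕ) : Type := Metric.sphere (0 : EuclideanSpace ℝ (Fin d)) 1

/-- The coordinates of the point `(x, t) = (tξ, t)` of the cone. -/
def conePoint {d : ℕ} (ξ : UnitSphere d) (t : ℝ) : Fin (d + 1) → ℝ :=
  Fin.snoc (fun i => t * ξ.1 i) t

theorem aeval_conePoint_coneQuadric {d : ℕ} (ξ : UnitSphere d) (t : ℝ) :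
    aeval (conePoint ξ t) (coneQuadric d) = 0 := by
  have h : ∑ i, ξ.1 i ^ 2 = 1 := by
    rw [← EuclideanSpace.real_norm_sq_eq, norm_eq_of_mem_sphere ξ, one_pow]
  simp [coneQuadric, conePoint, mul_pow, ← Finset.mul_sum, h]

/-- The value of a polynomial on the cone at the point `(tξ, t)`. -/
def coneVal {d : ℕ} (ξ : UnitSphere d) (t : ℝ) : ConePoly d →ₐ[ℝ] ℝ :=
  Ideal.Quotient.liftₐ _ (aeval (conePoint ξ t)) fun p hp => by
    obtain ⟨q, rfl⟩ := Ideal.mem_span_singleton'.1 hp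
    rw [map_mul, aeval_conePoint_coneQuadric, mul_zero]

theorem coneVal_coneMk {d : ℕ} (ξ : UnitSphere d) (t : ℝ) (P : MvPolynomial (Fin (d + 1)) ℝ) :
    coneVal ξ t (coneMk d P) = aeval (conePoint ξ t) P := rfl

/-- The polynomials on the cone of degree at most `n`; this is the zero space if `n < 0`. -/
def conePolyLE (d : ℕ) (n : ℤ) : Submodule ℝ (ConePoly d) :=
  (restrictSupport ℝ {m : Fin (d + 1) →₀ ℕ | (m.degree : ℤ) ≤ n}).map (coneMk d).toLinearMap

/-! ### Integration -/

/-- The surface measure of the unit sphere. -/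
def sphereMeasure (d : ℕ) : Measure (UnitSphere d) :=
  (volume : Measure (EuclideanSpace ℝ (Fin d))).toSphere

instance (d : ℕ) : IsFiniteMeasure (sphereMeasure d) := by
  unfold sphereMeasure; infer_instance

/-- The surface area `ω_d` of the unit sphere. -/
def sphereArea (d : ℕ) : ℝ := (sphereMeasure d).real Set.univ

/-- The integral over the conic surface `{(x, t) : ‖x‖ = t, 0 ≤ t ≤ 1}` with respect to its
Lebesgue measure, `∫ f dm = ∫₀¹ t^(d-1) ∫ f(tξ, t) dσ(ξ) dt`, for `f` given as a function
of `(ξ, t)`. -/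
def coneIntegral (d : ℕ) (f : UnitSphere d → ℝ → ℝ) : ℝ :=
  ∫ t in (0 : ℝ)..1, t ^ (d - 1) * ∫ ξ, f ξ t ∂(sphereMeasure d)

/-- The Jacobi weight `t^β (1 - t)^γ`. -/
def jacobiWeight (β γ t : ℝ) : ℝ := t ^ β * (1 - t) ^ γ

theorem continuous_coneVal {d : ℕ} (u : ConePoly d) :
    Continuous fun p : ℝ × UnitSphere d => coneVal p.2 p.1 u := by
  obtain ⟨P, rfl⟩ := Ideal.Quotient.mkₐ_surjective ℝ _ u
  change Continuous fun p : ℝ × UnitSphere d => aeval (conePoint p.2 p.1) P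
  have h : Continuous fun p : ℝ × UnitSphere d => conePoint p.2 p.1 := by
    refine continuous_pi fun i => ?_
    refine Fin.lastCases ?_ (fun j => ?_) i
    · simpa [conePoint] using continuous_fst
    · simp only [conePoint, Fin.snoc_castSucc]
      fun_prop
  exact (MvPolynomial.continuous_eval P).comp h

theorem intervalIntegrable_jacobi {a c : ℝ} (ha : -1 < a) (hc : -1 < c) :
    IntervalIntegrable (fun t : ℝ => t ^ a * (1 - t) ^ c) volume 0 1 := by
  have h := (Complex.betaIntegral_convergent (u := (a + 1 : ℝ)) (v := (c + 1 : ℝ))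
    (by simp; linarith) (by simp; linarith)).norm
  rw [intervalIntegrable_iff_integrableOn_Ioo_of_le zero_le_one] at h ⊢
  refine h.congr_fun (fun t ht => ?_) measurableSet_Ioo
  have h1 : (0 : ℝ) < 1 - t := sub_pos.2 ht.2
  have e : (1 : ℂ) - (t : ℂ) = ((1 - t : ℝ) : ℂ) := by push_cast; rfl
  simp only [norm_mul]
  rw [e, Complex.norm_cpow_eq_rpow_re_of_pos ht.1, Complex.norm_cpow_eq_rpow_re_of_pos h1]
  simp

/-- The integrals that define the inner products converge. -/
theorem intervalIntegrable_cone {d : ℕ} (hd : 2 ≤ d) {β γ : ℝ} (hβ : -(d : ℝ) < β) (hγ : -1 < γ)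
    (u : ConePoly d) :
    IntervalIntegrable (fun t : ℝ => t ^ (d - 1) *
      ∫ ξ, coneVal ξ t u * jacobiWeight β γ t ∂(sphereMeasure d)) volume 0 1 := by
  have hd' : ((d - 1 : ℕ) : ℝ) = (d : ℝ) - 1 := by
    rw [Nat.cast_sub (by omega)]; simp
  have hc : Continuous fun t : ℝ => ∫ ξ, coneVal ξ t u ∂(sphereMeasure d) := by
    have := continuous_parametric_integral_of_continuous (μ := sphereMeasure d)
      (f := fun (t : ℝ) (ξ : UnitSphere d) => coneVal ξ t u) (continuous_coneVal u)
      (s := Set.univ) isCompact_univ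
    simpa using this
  have h := (intervalIntegrable_jacobi (a := (d - 1 : ℕ) + β) (c := γ)
    (by rw [hd']; linarith) hγ).mul_continuousOn hc.continuousOn
  rw [intervalIntegrable_iff_integrableOn_Ioo_of_le zero_le_one] at h ⊢
  refine h.congr_fun (fun t ht => ?_) measurableSet_Ioo
  simp only [jacobiWeight]
  rw [integral_mul_const, Real.rpow_add ht.1, Real.rpow_natCast]
  ring

/-- The linear functional `u ↦ ∫ u(x, t) t^β (1 - t)^γ dm(x, t)` over the conic surface. -/
def coneWeightedIntegral {d : ℕ} (hd : 2 ≤ d) {β γ : ℝ} (hβ : -(d : ℝ) < β) (hγ : -1 < γ) :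
    ConePoly d →ₗ[ℝ] ℝ where
  toFun u := coneIntegral d fun ξ t => coneVal ξ t u * jacobiWeight β γ t
  map_add' u v := by
    unfold coneIntegral
    rw [← intervalIntegral.integral_add (intervalIntegrable_cone hd hβ hγ u)
      (intervalIntegrable_cone hd hβ hγ v)]
    refine intervalIntegral.integral_congr fun t _ => ?_
    have hi : ∀ w : ConePoly d,
        Integrable (fun ξ => coneVal ξ t w) (sphereMeasure d) := fun w =>
      ((continuous_coneVal w).comp (by fun_prop :
        Continuous fun ξ : UnitSphere d => (t, ξ))).integrable_of_hasCompactSupport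
        (HasCompactSupport.of_compactSpace _)
    simp only [integral_mul_const, map_add, integral_add (hi u) (hi v)]
    ring
  map_smul' c u := by
    unfold coneIntegral
    rw [RingHom.id_apply, smul_eq_mul, ← intervalIntegral.integral_const_mul]
    refine intervalIntegral.integral_congr fun t _ => ?_
    simp only [integral_mul_const, map_smul, smul_eq_mul, integral_const_mul]
    ring

/-- The linear functional `u ↦ ∫ u(ξ, 1) dσ(ξ)` over the unit sphere. -/
def coneBoundaryIntegral (d : ℕ) : ConePoly d →ₗ[ℝ] ℝ where
  toFun u := ∫ ξ, coneVal ξ 1 u ∂(sphereMeasure d)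
  map_add' u v := by
    have hi : ∀ w : ConePoly d,
        Integrable (fun ξ => coneVal ξ 1 w) (sphereMeasure d) := fun w =>
      ((continuous_coneVal w).comp (by fun_prop :
        Continuous fun ξ : UnitSphere d => ((1 : ℝ), ξ))).integrable_of_hasCompactSupport
        (HasCompactSupport.of_compactSpace _)
    simp only [map_add, integral_add (hi u) (hi v)]
  map_smul' c u := by
    simp only [map_smul, smul_eq_mul, integral_const_mul, RingHom.id_apply]

/-! ### The derivative `∂/∂t` on the conic surface

A polynomial on the cone is, in exactly one way, the restriction of a polynomial `P(x, t)` that is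
harmonic in `x`, that is, of a sum of products `p(t) Y(x)` with `Y` a solid harmonic. The
derivative `∂/∂t` on the cone is `∂_{d+1}` applied to this representation, so that
`∂/∂t (p(t) Y(x)) = p'(t) Y(x)`. -/

/-- The Laplace operator in the variables `x`. -/
def xLaplacian (d : ℕ) :
    MvPolynomial (Fin (d + 1)) ℝ →ₗ[ℝ] MvPolynomial (Fin (d + 1)) ℝ :=
  ∑ i : Fin d, (pderiv i.castSucc).toLinearMap ∘ₗ (pderiv i.castSucc).toLinearMap

/-- The polynomials in `(x, t)` that are harmonic in `x`. -/
def xHarmonic (d : ℕ) : Submodule ℝ (MvPolynomial (Fin (d + 1)) ℝ) :=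
  LinearMap.ker (xLaplacian d)

theorem xLaplacian_apply {d : ℕ} (q : MvPolynomial (Fin (d + 1)) ℝ) :
    xLaplacian d q = ∑ i : Fin d, pderiv i.castSucc (pderiv i.castSucc q) := by
  simp [xLaplacian, LinearMap.sum_apply]

theorem pderiv_pderiv_comm {σ : Type*} (i j : σ) (q : MvPolynomial σ ℝ) :
    pderiv i (pderiv j q) = pderiv j (pderiv i q) := by
  classical
  ext m
  simp only [coeff_pderiv, add_right_comm m, Finsupp.add_apply, Finsupp.single_apply]
  by_cases h : i = j
  · subst h; rfl
  · simp [h, Ne.symm h]; ring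

/-- The Euler operator `∑ xᵢ ∂ᵢ` in the variables `x`. -/
def xEuler (d : ℕ) (q : MvPolynomial (Fin (d + 1)) ℝ) : MvPolynomial (Fin (d + 1)) ℝ :=
  ∑ i : Fin d, X i.castSucc * pderiv i.castSucc q

theorem xLaplacian_coneQuadric_mul {d : ℕ} (q : MvPolynomial (Fin (d + 1)) ℝ) :
    xLaplacian d (coneQuadric d * q) =
      coneQuadric d * xLaplacian d q - (2 * (d : MvPolynomial (Fin (d + 1)) ℝ) * q
        + 4 * xEuler d q) := by
  have h1 : ∀ i : Fin d, pderiv i.castSucc (coneQuadric d) = -2 * X i.castSucc := by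
    intro i
    have hne : Fin.last d ≠ i.castSucc := (Fin.castSucc_lt_last i).ne'
    simp only [coneQuadric, map_sub, map_sum, Derivation.leibniz_pow, pderiv_X_of_ne hne]
    rw [Finset.sum_eq_single i]
    · simp
    · intro j _ hj
      rw [pderiv_X_of_ne (by simpa using hj)]; simp
    · simp
  have h2 : ∀ i : Fin d, pderiv i.castSucc (pderiv i.castSucc (coneQuadric d * q)) =
      coneQuadric d * pderiv i.castSucc (pderiv i.castSucc q) - (2 * q
        + 4 * (X i.castSucc * pderiv i.castSucc q)) := by
    intro i
    have h3 : pderiv i.castSucc (-2 * X i.castSucc : MvPolynomial (Fin (d + 1)) ℝ) = -2 := by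
      have : (-2 : MvPolynomial (Fin (d + 1)) ℝ) = C (-2) := by
        rw [map_neg, map_ofNat]
      rw [this, pderiv_C_mul, pderiv_X_self, mul_one]
    simp only [pderiv_mul, map_add, h1, h3]
    ring
  simp only [xLaplacian_apply, h2, Finset.sum_sub_distrib, Finset.sum_add_distrib, xEuler,
    Finset.mul_sum, Finset.sum_const, Finset.card_univ, Fintype.card_fin, nsmul_eq_mul]
  ring

theorem xLaplacian_xEuler {d : ℕ} (q : MvPolynomial (Fin (d + 1)) ℝ) :
    xLaplacian d (xEuler d q) = xEuler d (xLaplacian d q) + 2 * xLaplacian d q := by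
  have h : ∀ i j : Fin d, pderiv i.castSucc (pderiv i.castSucc
      (X j.castSucc * pderiv j.castSucc q)) =
      X j.castSucc * pderiv j.castSucc (pderiv i.castSucc (pderiv i.castSucc q)) +
        if i = j then 2 * pderiv i.castSucc (pderiv i.castSucc q) else 0 := by
    intro i j
    rw [pderiv_pderiv_comm j.castSucc i.castSucc (pderiv i.castSucc q),
      pderiv_pderiv_comm j.castSucc i.castSucc q]
    by_cases hij : i = j
    · subst hij
      simp; ring
    · have hne : j.castSucc ≠ i.castSucc := by simpa using Ne.symm hij
      simp [pderiv_X_of_ne hne, hij]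
  simp only [xLaplacian_apply, xEuler, map_sum, h, Finset.sum_add_distrib, Finset.mul_sum]
  rw [Finset.sum_comm]
  simp

theorem coeff_xEuler {d : ℕ} (q : MvPolynomial (Fin (d + 1)) ℝ) (m : Fin (d + 1) →₀ ℕ) :
    coeff m (xEuler d q) = (∑ i : Fin d, (m i.castSucc : ℝ)) * coeff m q := by
  classical
  simp only [xEuler, coeff_sum, Finset.sum_mul]
  refine Finset.sum_congr rfl fun i _ => ?_
  rw [coeff_X_mul']
  split_ifs with hi
  · have h1 : m - Finsupp.single i.castSucc 1 + Finsupp.single i.castSucc 1 = m := by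
      ext k
      by_cases hk : k = i.castSucc
      · subst hk
        have := Finsupp.mem_support_iff.1 hi
        simp; omega
      · simp [Ne.symm hk]
    rw [coeff_pderiv, h1]
    have h2 : m i.castSucc ≠ 0 := Finsupp.mem_support_iff.1 hi
    have h3 : (m - Finsupp.single i.castSucc 1 : Fin (d + 1) →₀ ℕ) i.castSucc + 1 = m i.castSucc := by
      simp; omega
    rw [← h3]; push_cast; ring
  · simp [Finsupp.notMem_support_iff.1 hi]

theorem degree_of_mem_support_xLaplacian {d : ℕ} {q : MvPolynomial (Fin (d + 1)) ℝ} {N : ℕ}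
    (hq : ∀ m ∈ q.support, m.degree < N + 2) : ∀ m ∈ (xLaplacian d q).support, m.degree < N := by
  intro m hm
  rw [mem_support_iff, xLaplacian_apply, coeff_sum] at hm
  obtain ⟨i, -, hi⟩ := Finset.exists_ne_zero_of_sum_ne_zero hm
  rw [coeff_pderiv, coeff_pderiv] at hi
  have h := hq _ (mem_support_iff.2 (left_ne_zero_of_mul (left_ne_zero_of_mul hi)))
  simp only [map_add, Finsupp.degree_single] at h
  omega

theorem eq_zero_of_coneQuadric_mul_xLaplacian {d : ℕ} (N : ℕ) :
    ∀ (q : MvPolynomial (Fin (d + 1)) ℝ) (c a : ℝ), (∀ m ∈ q.support, m.degree < N) → 0 < c →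
      0 ≤ a → coneQuadric d * xLaplacian d q = C c * q + C a * xEuler d q → q = 0 := by
  induction N with
  | zero =>
    intro q c a hq _ _ _
    rw [← support_eq_empty]
    exact Finset.eq_empty_of_forall_notMem fun m hm => absurd (hq m hm) (by simp)
  | succ N ih =>
    intro q c a hq hc ha h
    have hr : xLaplacian d q = 0 := by
      refine ih _ (c + 2 * d + 2 * a) (a + 4)
        (fun m hm => degree_of_mem_support_xLaplacian (N := N)
          (fun k hk => (hq k hk).trans (by omega)) m hm) (by positivity) (by positivity) ?_
      have h' := congrArg (xLaplacian d) h
      rw [xLaplacian_coneQuadric_mul, map_add, ← smul_eq_C_mul, ← smul_eq_C_mul, map_smul,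
        map_smul, xLaplacian_xEuler, smul_eq_C_mul, smul_eq_C_mul] at h'
      have e1 : (C (c + 2 * d + 2 * a) : MvPolynomial (Fin (d + 1)) ℝ) =
          C c + 2 * (d : MvPolynomial (Fin (d + 1)) ℝ) + 2 * C a := by
        simp only [map_add, map_mul, map_ofNat, map_natCast]
      have e2 : (C (a + 4) : MvPolynomial (Fin (d + 1)) ℝ) = C a + 4 := by
        rw [map_add, map_ofNat]
      rw [e1, e2]
      linear_combination h'
    rw [hr, mul_zero] at h
    ext m
    have hm := congrArg (coeff m) h
    rw [coeff_add, coeff_C_mul, coeff_C_mul, coeff_xEuler, coeff_zero] at hm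
    have hp : 0 < c + a * ∑ i : Fin d, (m i.castSucc : ℝ) := by positivity
    have : (c + a * ∑ i : Fin d, (m i.castSucc : ℝ)) * coeff m q = 0 := by linarith
    simpa [hp.ne'] using this

theorem eq_zero_of_xLaplacian_coneQuadric_mul {d : ℕ} (hd : 2 ≤ d)
    {q : MvPolynomial (Fin (d + 1)) ℝ} (h : xLaplacian d (coneQuadric d * q) = 0) : q = 0 := by
  refine eq_zero_of_coneQuadric_mul_xLaplacian (q.totalDegree + 1) q (2 * d) 4
    (fun m hm => Nat.lt_succ_of_le ?_) (by positivity) (by norm_num) ?_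
  · simpa [Finsupp.degree_eq_sum, Finsupp.sum_fintype] using le_totalDegree hm
  · rw [xLaplacian_coneQuadric_mul] at h
    have e1 : (C (2 * d) : MvPolynomial (Fin (d + 1)) ℝ) = 2 * d := by
      rw [map_mul, map_ofNat, map_natCast]
    have e2 : (C 4 : MvPolynomial (Fin (d + 1)) ℝ) = 4 := map_ofNat C 4
    rw [e1, e2]
    linear_combination h

theorem xLaplacian_coneQuadric_mul_surjective {d : ℕ} (hd : 2 ≤ d)
    (p : MvPolynomial (Fin (d + 1)) ℝ) : ∃ q, xLaplacian d (coneQuadric d * q) = p := by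
  let N := p.totalDegree
  let T : MvPolynomial (Fin (d + 1)) ℝ →ₗ[ℝ] MvPolynomial (Fin (d + 1)) ℝ :=
    xLaplacian d ∘ₗ LinearMap.mulLeft ℝ (coneQuadric d)
  have hQ : (coneQuadric d).totalDegree ≤ 2 := by
    refine (totalDegree_sub _ _).trans (max_le ?_ ?_)
    · simp [totalDegree_X_pow]
    · exact totalDegree_finsetSum_le fun i _ => by simp [totalDegree_X_pow]
  have hT : ∀ q ∈ restrictTotalDegree (Fin (d + 1)) ℝ N,
      T q ∈ restrictTotalDegree (Fin (d + 1)) ℝ N := by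
    intro q hq
    rw [mem_restrictTotalDegree] at hq ⊢
    have h1 : (coneQuadric d * q).totalDegree ≤ N + 2 :=
      (totalDegree_mul _ _).trans (by omega)
    have h2 := degree_of_mem_support_xLaplacian (q := coneQuadric d * q) (N := N + 1)
      fun m hm => by
        have := le_totalDegree hm
        rw [Finsupp.degree_eq_sum]
        rw [Finsupp.sum_fintype _ _ (by simp)] at this
        omega
    refine Finset.sup_le fun m hm => ?_
    have := h2 m hm
    rw [Finsupp.degree_eq_sum] at this
    rw [Finsupp.sum_fintype _ _ (by simp)]
    omega
  have hi : Function.Injective (T.restrict hT) := by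
    rw [injective_iff_map_eq_zero]
    intro q hq
    exact Subtype.ext (eq_zero_of_xLaplacian_coneQuadric_mul hd (congrArg Subtype.val hq))
  obtain ⟨q, hq⟩ := LinearMap.injective_iff_surjective.1 hi
    ⟨p, (mem_restrictTotalDegree _ _ _).2 le_rfl⟩
  exact ⟨q.1, congrArg Subtype.val hq⟩

/-- Every polynomial on the cone has exactly one representative that is harmonic in `x`. -/
theorem xHarmonic_bijective {d : ℕ} (hd : 2 ≤ d) :
    Function.Bijective ((coneMk d).toLinearMap ∘ₗ (xHarmonic d).subtype) := by
  constructor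
  · rw [injective_iff_map_eq_zero]
    rintro ⟨P, hP⟩ h
    obtain ⟨q, rfl⟩ := Ideal.mem_span_singleton.1 (Ideal.Quotient.eq_zero_iff_mem.1 h)
    have : q = 0 := eq_zero_of_xLaplacian_coneQuadric_mul hd hP
    simp [this]
  · intro u
    obtain ⟨P, rfl⟩ := Ideal.Quotient.mkₐ_surjective ℝ _ u
    obtain ⟨q, hq⟩ := xLaplacian_coneQuadric_mul_surjective hd (xLaplacian d P)
    refine ⟨⟨P - coneQuadric d * q, ?_⟩, ?_⟩
    · simp [xHarmonic, hq]
    · refine Ideal.Quotient.eq.2 ?_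
      rw [Ideal.mem_span_singleton]
      exact ⟨-q, by simp⟩

/-- The representative of a polynomial on the cone that is harmonic in `x`. -/
def harmonicRep {d : ℕ} (hd : 2 ≤ d) : ConePoly d ≃ₗ[ℝ] xHarmonic d :=
  (LinearEquiv.ofBijective _ (xHarmonic_bijective hd)).symm

/-- The derivative `∂/∂t` on the conic surface. -/
def coneDt {d : ℕ} (hd : 2 ≤ d) : ConePoly d →ₗ[ℝ] ConePoly d :=
  (coneMk d).toLinearMap ∘ₗ (pderiv (Fin.last d)).toLinearMap ∘ₗ (xHarmonic d).subtype ∘ₗ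
    (harmonicRep hd).toLinearMap

/-- The defining property of `∂/∂t`: if `P(x, t)` is harmonic in `x`, then `∂/∂t` of its
restriction to the cone is the restriction of `∂_{d+1} P`. -/
theorem coneDt_coneMk {d : ℕ} (hd : 2 ≤ d) {P : MvPolynomial (Fin (d + 1)) ℝ}
    (hP : P ∈ xHarmonic d) : coneDt hd (coneMk d P) = coneMk d (pderiv (Fin.last d) P) := by
  have h : harmonicRep hd (coneMk d P) = ⟨P, hP⟩ :=
    (LinearEquiv.symm_apply_eq _).2 rfl
  simp [coneDt, h]

/-! ### Orthogonal polynomials on the conic surface -/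

/-- The normalization constant
`b_{β,γ} = ω_d⁻¹ Γ(β + γ + d + 1) / (Γ(β + d) Γ(γ + 1))`, for which `⟨1, 1⟩_{β,γ} = 1`. -/
def coneNorm (d : ℕ) (β γ : ℝ) : ℝ :=
  (sphereArea d)⁻¹ * (Real.Gamma (β + γ + d + 1) / (Real.Gamma (β + d) * Real.Gamma (γ + 1)))

/-- The inner product `⟨f, g⟩_{β,γ} = b_{β,γ} ∫ f g t^β (1 - t)^γ dm`, for `β > -d` and
`γ > -1`. -/
def jacobiInner {d : ℕ} (hd : 2 ≤ d) (β γ : ℝ) (hβ : -(d : ℝ) < β) (hγ : -1 < γ) :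
    LinearMap.BilinForm ℝ (ConePoly d) :=
  coneNorm d β γ • (LinearMap.mul ℝ (ConePoly d)).compr₂ (coneWeightedIntegral hd hβ hγ)

/-- The Sobolev inner product
`⟨f, g⟩_{β,-1} = ω_d⁻¹ ∫ ∂f/∂t ∂g/∂t t^(β+1) dm + λ ω_d⁻¹ ∫ f(ξ, 1) g(ξ, 1) dσ(ξ)`,
for `β > -d - 1`. -/
def sobolevInner {d : ℕ} (hd : 2 ≤ d) (β : ℝ) (hβ : -(d : ℝ) < β + 1) (lam : ℝ) :
    LinearMap.BilinForm ℝ (ConePoly d) :=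
  (sphereArea d)⁻¹ • ((LinearMap.mul ℝ (ConePoly d)).compr₂
      (coneWeightedIntegral hd hβ (by norm_num : (-1 : ℝ) < 0))).compl₁₂ (coneDt hd) (coneDt hd)
    + (lam * (sphereArea d)⁻¹) •
      (LinearMap.mul ℝ (ConePoly d)).compr₂ (coneBoundaryIntegral d)

/-- The space of orthogonal polynomials of degree `n` for `B`: the polynomials on the cone of
degree at most `n` that are orthogonal to all those of degree at most `n - 1`. It is the zero
space if `n < 0`. -/
def orthPoly {d : ℕ} (B : LinearMap.BilinForm ℝ (ConePoly d)) (n : ℤ) :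
    Submodule ℝ (ConePoly d) :=
  conePolyLE d n ⊓ B.orthogonal (conePolyLE d (n - 1))

/-- The space `V_n^d(w_{β,γ})` for `β > -d` and `γ > -1`. -/
def jacobiSpace {d : ℕ} (hd : 2 ≤ d) (β γ : ℝ) (hβ : -(d : ℝ) < β) (hγ : -1 < γ) (n : ℤ) :
    Submodule ℝ (ConePoly d) :=
  orthPoly (jacobiInner hd β γ hβ hγ) n

/-- The space `V_n^d(w_{β,-1})` of Sobolev orthogonal polynomials, for `β > -d - 1`. -/
def sobolevSpace {d : ℕ} (hd : 2 ≤ d) (β : ℝ) (hβ : -(d : ℝ) < β + 1) (lam : ℝ) (n : ℤ) :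
    Submodule ℝ (ConePoly d) :=
  orthPoly (sobolevInner hd β hβ lam) n

/-! ### Solid harmonics and the differential operator -/

/-- The homogeneous harmonic polynomials of degree `n` in `x₁, …, x_d`. -/
def solidHarmonic (d n : ℕ) : Submodule ℝ (MvPolynomial (Fin d) ℝ) :=
  homogeneousSubmodule (Fin d) ℝ n ⊓
    LinearMap.ker (∑ i : Fin d, (pderiv i).toLinearMap ∘ₗ (pderiv i).toLinearMap)

/-- The space `H_n^{d,0}` of solid harmonics `Y(x)`, as polynomials on the cone. -/
def coneSolidHarmonic (d n : ℕ) : Submodule ℝ (ConePoly d) :=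
  (solidHarmonic d n).map ((coneMk d).comp (rename Fin.castSucc)).toLinearMap

open Classical in
/-- The function `y ↦ h(y / ‖y‖)` on `ℝ^d`, with the value `0` at the origin. -/
def radialExtension {d : ℕ} (h : UnitSphere d → ℝ) (y : EuclideanSpace ℝ (Fin d)) : ℝ :=
  if hy : y = 0 then 0
  else h ⟨‖y‖⁻¹ • y, by simp [norm_smul, hy]⟩

/-- The Laplace–Beltrami operator `Δ₀` of the unit sphere: the restriction to the sphere of the
Laplacian of `y ↦ h(y / ‖y‖)`. -/
def laplaceBeltrami {d : ℕ} (h : UnitSphere d → ℝ) (ξ : UnitSphere d) : ℝ :=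
  Laplacian.laplacian (radialExtension h) ξ.1

/-- The differential operator
`D_γ = t(1 - t) d²/dt² + (d - 1 - (d + γ) t) d/dt + t⁻¹ Δ₀^{(ξ)}`
acting on a function `f` of `(ξ, t)`, where `(x, t) = (tξ, t)`. -/
def coneOperator (d : ℕ) (γ : ℝ) (f : UnitSphere d → ℝ → ℝ) (ξ : UnitSphere d) (t : ℝ) : ℝ :=
  t * (1 - t) * iteratedDeriv 2 (f ξ) t + (d - 1 - (d + γ) * t) * deriv (f ξ) t
    + t⁻¹ * laplaceBeltrami (fun η => f η t) ξ

theorem neg_natCast_lt_neg_one {d : ℕ} (hd : 2 ≤ d) : -(d : ℝ) < -1 := by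
  have : (2 : ℝ) ≤ d := by exact_mod_cast hd
  linarith

theorem neg_natCast_lt_neg_one_add_one {d : ℕ} (hd : 2 ≤ d) : -(d : ℝ) < -1 + 1 := by
  have := neg_natCast_lt_neg_one hd
  linarith

end

noncomputable section

open MvPolynomial MeasureTheory

/-! ### Diagonal operators on polynomials in `(x, t)` -/

/-! Every class of degree at most `n` on the cone has a representative of degree at most `n` that is
harmonic in `x`, and `∂/∂t` is computed on such representatives. So the proof works with polynomials
`P(x, t)` in `xHarmonic d`, and the inner products become integrals of polynomials (`coneMoment`,
`sphereMoment`, `sobolevMoment`).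

Let `E` be the Euler operator in `x`, `N = E + t∂ₜ` the full one, and `L = t∂ₜ² + (2E + d - 1)∂ₜ`
(`radialOp`). On the sphere `Δ₀` acts on harmonic representatives as `-E(E + d - 2)`, so `D_{-1}`
becomes `coneOp`, that is `(1 - t)L - E(E + d - 2)`. Three facts carry the theorem.

Symmetry: `E` is symmetric for integration over the sphere, because harmonics of different degrees
are orthogonal there. Integrating by parts along the rays gives `⟨(1 - t)P, Q⟩ = -∫ t^(d-2) (1 - t)
P · LQ` for the Sobolev form (`sobolevMoment_one_sub_X_last_mul`), with no boundary term. Taking `P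
= LA` shows that `coneOp` is symmetric (`sobolevMoment_coneOp`).

Triangularity: `tL = N(N + d - 2) - E(E + d - 2)`, so `coneOp = L - N(N + d - 2)`, and `L` lowers
the degree by one. For `c = n(n + d - 2)`, `coneOp + c` maps degree `≤ n` to degree `≤ n - 1`.

Definiteness: a harmonic representative with Sobolev norm zero vanishes
(`eq_zero_of_sobolevMoment`).

If `Z` lies in the Sobolev space of degree `n`, then `W = (coneOp + c)Z` has degree `≤ n - 1`, and
`⟨W, W⟩ = ⟨Z, (coneOp + c)W⟩ = 0`, so `W = 0`: this is the differential equation. For the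
decomposition, testing `Z` against polynomials free of `t` shows that `Z(·, 1)` is a solid harmonic
`Y` of degree `n`; hence `Z = Y + (1 - t)P`. By the formula above and the surjectivity of `L` from
degree `≤ n - 1` onto degree `≤ n - 2` (`exists_radialOp_eq`), `P` is orthogonal for the weight
`t⁻¹(1 - t)`. The same formula gives the converse inclusion, and setting `t = 1` shows that the sum
is direct. -/

/-- The degree in `x` of the monomial with exponent `m`. -/
def xDegree {d : ℕ} (m : Fin (d + 1) →₀ ℕ) : ℕ := ∑ i : Fin d, m i.castSucc

theorem degree_eq_xDegree_add {d : ℕ} (m : Fin (d + 1) →₀ ℕ) :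
    m.degree = xDegree m + m (Fin.last d) := by
  rw [Finsupp.degree_eq_sum, Fin.sum_univ_castSucc, xDegree]

theorem xDegree_add {d : ℕ} (m k : Fin (d + 1) →₀ ℕ) : xDegree (m + k) = xDegree m + xDegree k := by
  simp [xDegree, Finset.sum_add_distrib]

theorem xDegree_single_castSucc {d : ℕ} (i : Fin d) (k : ℕ) :
    xDegree (Finsupp.single i.castSucc k) = k := by
  classical
  simp [xDegree, Finsupp.single_apply]

theorem xDegree_single_last {d : ℕ} (k : ℕ) : xDegree (Finsupp.single (Fin.last d) k) = 0 := by
  simp [xDegree]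

/-- The operator that multiplies the monomials of degree `a` in `x` and `b` in `t` by `φ a b`. -/
def diagOp (d : ℕ) (φ : ℕ → ℕ → ℝ) :
    MvPolynomial (Fin (d + 1)) ℝ →ₗ[ℝ] MvPolynomial (Fin (d + 1)) ℝ :=
  (basisMonomials (Fin (d + 1)) ℝ).constr ℝ fun m =>
    monomial m (φ (xDegree m) (m (Fin.last d)))

theorem diagOp_monomial {d : ℕ} (φ : ℕ → ℕ → ℝ) (m : Fin (d + 1) →₀ ℕ) (c : ℝ) :
    diagOp d φ (monomial m c) = monomial m (φ (xDegree m) (m (Fin.last d)) * c) := by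
  have h : (monomial m c : MvPolynomial (Fin (d + 1)) ℝ) = c • basisMonomials _ ℝ m := by
    simp [smul_monomial]
  rw [h, map_smul, diagOp, Module.Basis.constr_basis, smul_monomial, smul_eq_mul, mul_comm]

theorem coeff_diagOp {d : ℕ} (φ : ℕ → ℕ → ℝ) (P : MvPolynomial (Fin (d + 1)) ℝ)
    (m : Fin (d + 1) →₀ ℕ) :
    coeff m (diagOp d φ P) = φ (xDegree m) (m (Fin.last d)) * coeff m P := by
  classical
  induction P using MvPolynomial.induction_on' with
  | monomial k c =>
    rw [diagOp_monomial, coeff_monomial, coeff_monomial]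
    split_ifs with h
    · rw [h]
    · simp
  | add p q hp hq => rw [map_add, coeff_add, coeff_add, hp, hq, mul_add]

/-- The operators `E`, `t∂ₜ`, the projections to homogeneous components and the inverses used below
are all diagonal on monomials, so relations among them reduce to identities between functions of the
two degrees. -/
theorem diagOp_diagOp {d : ℕ} (φ ψ : ℕ → ℕ → ℝ) (P : MvPolynomial (Fin (d + 1)) ℝ) :
    diagOp d φ (diagOp d ψ P) = diagOp d (fun a b => φ a b * ψ a b) P := by
  ext m; simp only [coeff_diagOp]; ring

theorem diagOp_add {d : ℕ} (φ ψ : ℕ → ℕ → ℝ) (P : MvPolynomial (Fin (d + 1)) ℝ) :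
    diagOp d (fun a b => φ a b + ψ a b) P = diagOp d φ P + diagOp d ψ P := by
  ext m; simp only [coeff_diagOp, coeff_add]; ring

theorem diagOp_sub {d : ℕ} (φ ψ : ℕ → ℕ → ℝ) (P : MvPolynomial (Fin (d + 1)) ℝ) :
    diagOp d (fun a b => φ a b - ψ a b) P = diagOp d φ P - diagOp d ψ P := by
  ext m; simp only [coeff_diagOp, coeff_sub]; ring

theorem diagOp_const {d : ℕ} (c : ℝ) (P : MvPolynomial (Fin (d + 1)) ℝ) :
    diagOp d (fun _ _ => c) P = c • P := by
  ext m; simp only [coeff_diagOp, coeff_smul, smul_eq_mul]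

theorem diagOp_eq_self {d : ℕ} {φ : ℕ → ℕ → ℝ} {P : MvPolynomial (Fin (d + 1)) ℝ}
    (h : ∀ m, coeff m P ≠ 0 → φ (xDegree m) (m (Fin.last d)) = 1) : diagOp d φ P = P := by
  ext m
  rw [coeff_diagOp]
  by_cases hm : coeff m P = 0
  · simp [hm]
  · rw [h m hm, one_mul]

theorem xEuler_eq_diagOp {d : ℕ} (P : MvPolynomial (Fin (d + 1)) ℝ) :
    xEuler d P = diagOp d (fun a _ => a) P := by
  ext m; rw [coeff_xEuler, coeff_diagOp, xDegree, Nat.cast_sum]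

theorem pderiv_castSucc_diagOp {d : ℕ} (φ : ℕ → ℕ → ℝ) (i : Fin d)
    (P : MvPolynomial (Fin (d + 1)) ℝ) :
    pderiv i.castSucc (diagOp d φ P) =
      diagOp d (fun a b => φ (a + 1) b) (pderiv i.castSucc P) := by
  ext m
  simp only [coeff_pderiv, coeff_diagOp, xDegree_add, xDegree_single_castSucc, Finsupp.add_apply]
  rw [Finsupp.single_eq_of_ne (Fin.castSucc_lt_last i).ne', add_zero, mul_assoc]

theorem pderiv_last_diagOp {d : ℕ} (φ : ℕ → ℕ → ℝ) (P : MvPolynomial (Fin (d + 1)) ℝ) :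
    pderiv (Fin.last d) (diagOp d φ P) =
      diagOp d (fun a b => φ a (b + 1)) (pderiv (Fin.last d) P) := by
  ext m
  simp only [coeff_pderiv, coeff_diagOp, xDegree_add, xDegree_single_last, Finsupp.add_apply,
    Finsupp.single_eq_same, add_zero, mul_assoc]

theorem xLaplacian_diagOp {d : ℕ} (φ : ℕ → ℕ → ℝ) (P : MvPolynomial (Fin (d + 1)) ℝ) :
    xLaplacian d (diagOp d φ P) = diagOp d (fun a b => φ (a + 1 + 1) b) (xLaplacian d P) := by
  simp only [xLaplacian_apply, pderiv_castSucc_diagOp, map_sum]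

theorem X_last_mul_pderiv_last {d : ℕ} (P : MvPolynomial (Fin (d + 1)) ℝ) :
    X (Fin.last d) * pderiv (Fin.last d) P = diagOp d (fun _ b => b) P := by
  classical
  ext m
  rw [coeff_X_mul', coeff_diagOp]
  split_ifs with h
  · have h2 : m (Fin.last d) ≠ 0 := Finsupp.mem_support_iff.1 h
    have h1 : m - Finsupp.single (Fin.last d) 1 + Finsupp.single (Fin.last d) 1 = m :=
      tsub_add_cancel_of_le (Finsupp.single_le_iff.2 (Nat.one_le_iff_ne_zero.2 h2))
    rw [coeff_pderiv, h1, mul_comm]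
    congr 1
    rw [Finsupp.tsub_apply, Finsupp.single_eq_same]
    exact_mod_cast Nat.succ_pred h2
  · simp [Finsupp.notMem_support_iff.1 h]

theorem pderiv_last_X_last_mul {d : ℕ} (P : MvPolynomial (Fin (d + 1)) ℝ) :
    pderiv (Fin.last d) (X (Fin.last d) * P) = diagOp d (fun _ b => b + 1) P := by
  rw [pderiv_mul, pderiv_X_self, one_mul, X_last_mul_pderiv_last,
    diagOp_add (fun _ b => (b : ℝ)) (fun _ _ => 1), diagOp_const, one_smul]
  exact add_comm _ _

theorem xLaplacian_X_last_mul {d : ℕ} (P : MvPolynomial (Fin (d + 1)) ℝ) :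
    xLaplacian d (X (Fin.last d) * P) = X (Fin.last d) * xLaplacian d P := by
  simp only [xLaplacian_apply, pderiv_mul, pderiv_X_of_ne (Fin.castSucc_lt_last _).ne', zero_mul,
    zero_add, Finset.mul_sum]

theorem xLaplacian_pderiv_last {d : ℕ} (P : MvPolynomial (Fin (d + 1)) ℝ) :
    xLaplacian d (pderiv (Fin.last d) P) = pderiv (Fin.last d) (xLaplacian d P) := by
  simp only [xLaplacian_apply, map_sum]
  refine Finset.sum_congr rfl fun i _ => ?_
  rw [pderiv_pderiv_comm i.castSucc (Fin.last d) P, pderiv_pderiv_comm i.castSucc (Fin.last d)]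

/-- The Laplacian lowers the degree in `x` by exactly two and keeps the degree in `t`, so it passes
through a diagonal operator up to a shift of `φ`. No condition on `φ` is needed, which allows
projections and formal inverses on harmonic representatives. -/
theorem diagOp_mem_xHarmonic {d : ℕ} (φ : ℕ → ℕ → ℝ) {P : MvPolynomial (Fin (d + 1)) ℝ}
    (hP : P ∈ xHarmonic d) : diagOp d φ P ∈ xHarmonic d := by
  rw [xHarmonic, LinearMap.mem_ker] at *
  rw [xLaplacian_diagOp, hP, map_zero]

theorem X_last_mul_mem_xHarmonic {d : ℕ} {P : MvPolynomial (Fin (d + 1)) ℝ}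
    (hP : P ∈ xHarmonic d) : X (Fin.last d) * P ∈ xHarmonic d := by
  rw [xHarmonic, LinearMap.mem_ker] at *
  rw [xLaplacian_X_last_mul, hP, mul_zero]

theorem pderiv_last_mem_xHarmonic {d : ℕ} {P : MvPolynomial (Fin (d + 1)) ℝ}
    (hP : P ∈ xHarmonic d) : pderiv (Fin.last d) P ∈ xHarmonic d := by
  rw [xHarmonic, LinearMap.mem_ker] at *
  rw [xLaplacian_pderiv_last, hP, map_zero]

theorem one_sub_X_last_mul_mem_xHarmonic_iff {d : ℕ} {P : MvPolynomial (Fin (d + 1)) ℝ} :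
    (1 - X (Fin.last d)) * P ∈ xHarmonic d ↔ P ∈ xHarmonic d := by
  have h : (1 - X (Fin.last d) : MvPolynomial (Fin (d + 1)) ℝ) ≠ 0 := by
    intro h
    simpa using congrArg (eval fun _ => (0 : ℝ)) h
  rw [xHarmonic, LinearMap.mem_ker, LinearMap.mem_ker, sub_mul, one_mul, map_sub,
    xLaplacian_X_last_mul]
  rw [show xLaplacian d P - X (Fin.last d) * xLaplacian d P =
    (1 - X (Fin.last d)) * xLaplacian d P by ring]
  simp [h]

/-! ### Degrees -/

/-- The polynomials in `(x, t)` of degree at most `n`. -/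
def polyLE (d : ℕ) (n : ℤ) : Submodule ℝ (MvPolynomial (Fin (d + 1)) ℝ) :=
  restrictSupport ℝ {m : Fin (d + 1) →₀ ℕ | (m.degree : ℤ) ≤ n}

theorem mem_polyLE {d : ℕ} {n : ℤ} {P : MvPolynomial (Fin (d + 1)) ℝ} :
    P ∈ polyLE d n ↔ ∀ m, coeff m P ≠ 0 → (m.degree : ℤ) ≤ n := by
  rw [polyLE, mem_restrictSupport_iff]
  exact ⟨fun h m hm => h (mem_support_iff.2 hm), fun h m hm => h m (mem_support_iff.1 hm)⟩

theorem polyLE_mono {d : ℕ} {n k : ℤ} (h : n ≤ k) : polyLE d n ≤ polyLE d k := fun P hP => by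
  rw [mem_polyLE] at *
  exact fun m hm => (hP m hm).trans h

theorem diagOp_mem_polyLE {d : ℕ} (φ : ℕ → ℕ → ℝ) {n : ℤ} {P : MvPolynomial (Fin (d + 1)) ℝ}
    (hP : P ∈ polyLE d n) : diagOp d φ P ∈ polyLE d n := by
  rw [mem_polyLE] at *
  intro m hm
  rw [coeff_diagOp] at hm
  exact hP m (right_ne_zero_of_mul hm)

theorem diagOp_mem_polyLE_sub_one {d : ℕ} {φ : ℕ → ℕ → ℝ} {n : ℤ}
    (hφ : ∀ a b : ℕ, (a : ℤ) + b = n → φ a b = 0) {P : MvPolynomial (Fin (d + 1)) ℝ}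
    (hP : P ∈ polyLE d n) : diagOp d φ P ∈ polyLE d (n - 1) := by
  rw [mem_polyLE] at *
  intro m hm
  rw [coeff_diagOp] at hm
  have h1 := hP m (right_ne_zero_of_mul hm)
  have h2 := mt (hφ (xDegree m) (m (Fin.last d))) (left_ne_zero_of_mul hm)
  rw [degree_eq_xDegree_add] at *
  push_cast at *
  omega

theorem pderiv_mem_polyLE {d : ℕ} (i : Fin (d + 1)) {n : ℤ} {P : MvPolynomial (Fin (d + 1)) ℝ}
    (hP : P ∈ polyLE d n) : pderiv i P ∈ polyLE d (n - 1) := by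
  rw [mem_polyLE] at *
  intro m hm
  rw [coeff_pderiv] at hm
  have := hP _ (left_ne_zero_of_mul hm)
  simp only [map_add, Finsupp.degree_single] at this
  push_cast at this
  omega

theorem X_mul_mem_polyLE {d : ℕ} (i : Fin (d + 1)) {n : ℤ} {P : MvPolynomial (Fin (d + 1)) ℝ}
    (hP : P ∈ polyLE d n) : X i * P ∈ polyLE d (n + 1) := by
  classical
  rw [mem_polyLE] at *
  intro m hm
  rw [coeff_X_mul'] at hm
  split_ifs at hm with hi
  · have h1 : m - Finsupp.single i 1 + Finsupp.single i 1 = m :=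
      tsub_add_cancel_of_le (Finsupp.single_le_iff.2 (Nat.one_le_iff_ne_zero.2
        (Finsupp.mem_support_iff.1 hi)))
    have := hP _ hm
    rw [← h1, map_add, Finsupp.degree_single]
    push_cast
    omega
  · exact absurd rfl hm

theorem mem_polyLE_natCast {d n : ℕ} {P : MvPolynomial (Fin (d + 1)) ℝ} :
    P ∈ polyLE d n ↔ P.totalDegree ≤ n := by
  rw [mem_polyLE, totalDegree, Finset.sup_le_iff]
  simp only [mem_support_iff, Nat.cast_le]
  refine forall₂_congr fun m _ => ?_
  rw [Finsupp.degree_eq_sum, Finsupp.sum_fintype _ _ (by simp)]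

theorem eq_zero_of_mem_polyLE_neg {d : ℕ} {n : ℤ} (hn : n < 0) {P : MvPolynomial (Fin (d + 1)) ℝ}
    (hP : P ∈ polyLE d n) : P = 0 := by
  rw [mem_polyLE] at hP
  ext m
  by_contra h
  have := hP m h
  omega

/-! ### Degrees under multiplication and division by `1 - t` -/

theorem totalDegree_one_sub_X_last (d : ℕ) :
    (1 - X (Fin.last d) : MvPolynomial (Fin (d + 1)) ℝ).totalDegree = 1 := by
  classical
  refine le_antisymm ((totalDegree_sub _ _).trans (by simp)) ?_
  have h : Finsupp.single (Fin.last d) 1 ∈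
      (1 - X (Fin.last d) : MvPolynomial (Fin (d + 1)) ℝ).support := by
    rw [mem_support_iff, coeff_sub, coeff_X, coeff_one, if_neg (by simp [eq_comm])]
    simp
  simpa using le_totalDegree h

theorem mem_polyLE_of_one_sub_X_last_mul {d n : ℕ} {P : MvPolynomial (Fin (d + 1)) ℝ}
    (h : (1 - X (Fin.last d)) * P ∈ polyLE d n) : P ∈ polyLE d (n - 1) := by
  by_cases hP : P = 0
  · rw [hP]; exact zero_mem _
  have h1 : (1 - X (Fin.last d) : MvPolynomial (Fin (d + 1)) ℝ) ≠ 0 := fun h0 => by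
    have := totalDegree_one_sub_X_last d
    rw [h0] at this
    simp at this
  rw [mem_polyLE_natCast, totalDegree_mul_of_isDomain h1 hP, totalDegree_one_sub_X_last] at h
  -- The factor `1 - t` has degree one and `P ≠ 0`, so `h` forces `1 ≤ n` and the natural
  -- subtraction is not truncated.
  have h2 : ((n : ℤ) - 1) = ((n - 1 : ℕ) : ℤ) := by omega
  rw [h2, mem_polyLE_natCast]
  omega

theorem one_sub_X_last_mul_mem_polyLE {d : ℕ} {n : ℤ} {P : MvPolynomial (Fin (d + 1)) ℝ}
    (h : P ∈ polyLE d (n - 1)) : (1 - X (Fin.last d)) * P ∈ polyLE d n := by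
  rw [sub_mul, one_mul]
  refine sub_mem (polyLE_mono (by omega) h) ?_
  simpa using X_mul_mem_polyLE (Fin.last d) h

/-! ### Harmonic representatives of controlled degree -/

theorem xLaplacian_mem_polyLE {d : ℕ} {n : ℤ} {P : MvPolynomial (Fin (d + 1)) ℝ}
    (hP : P ∈ polyLE d n) : xLaplacian d P ∈ polyLE d (n - 2) := by
  rw [xLaplacian_apply]
  refine sum_mem fun i _ => ?_
  have := pderiv_mem_polyLE i.castSucc (pderiv_mem_polyLE i.castSucc hP)
  rwa [sub_sub] at this

theorem coneQuadric_mul_mem_polyLE {d : ℕ} {n : ℤ} {P : MvPolynomial (Fin (d + 1)) ℝ}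
    (hP : P ∈ polyLE d n) : coneQuadric d * P ∈ polyLE d (n + 2) := by
  have h : ∀ i, X i ^ 2 * P ∈ polyLE d (n + 2) := fun i => by
    have := X_mul_mem_polyLE i (X_mul_mem_polyLE i hP)
    rwa [← mul_assoc, ← sq, add_assoc] at this
  rw [coneQuadric, sub_mul, Finset.sum_mul]
  exact sub_mem (h _) (sum_mem fun i _ => h _)

/-- The map `q ↦ Δ((t² - ‖x‖²) q)` is injective and preserves the finite-dimensional space `polyLE d
n`, hence is onto there. The bound on the degree of `q` is the point: it keeps the harmonic
representative within the degree of the class. -/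
theorem exists_xLaplacian_coneQuadric_mul_eq {d : ℕ} (hd : 2 ≤ d) {n : ℤ}
    {p : MvPolynomial (Fin (d + 1)) ℝ} (hp : p ∈ polyLE d n) :
    ∃ q ∈ polyLE d n, xLaplacian d (coneQuadric d * q) = p := by
  rcases lt_or_ge n 0 with hn | hn
  · exact ⟨0, zero_mem _, by rw [eq_zero_of_mem_polyLE_neg hn hp, mul_zero, map_zero]⟩
  lift n to ℕ using hn
  have hE : polyLE d n = restrictTotalDegree (Fin (d + 1)) ℝ n := by
    ext P; rw [mem_polyLE_natCast, mem_restrictTotalDegree]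
  have : FiniteDimensional ℝ (polyLE d n) := by rw [hE]; infer_instance
  let T : MvPolynomial (Fin (d + 1)) ℝ →ₗ[ℝ] MvPolynomial (Fin (d + 1)) ℝ :=
    xLaplacian d ∘ₗ LinearMap.mulLeft ℝ (coneQuadric d)
  have hT : ∀ q ∈ polyLE d n, T q ∈ polyLE d n := fun q hq => by
    have := xLaplacian_mem_polyLE (coneQuadric_mul_mem_polyLE hq)
    rwa [add_sub_cancel_right] at this
  have hi : Function.Injective (T.restrict hT) := by
    rw [injective_iff_map_eq_zero]
    intro q hq
    exact Subtype.ext (eq_zero_of_xLaplacian_coneQuadric_mul hd (congrArg Subtype.val hq))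
  obtain ⟨q, hq⟩ := LinearMap.injective_iff_surjective.1 hi ⟨p, hp⟩
  exact ⟨q.1, q.2, congrArg Subtype.val hq⟩

theorem coneMk_mem_conePolyLE {d : ℕ} {n : ℤ} {P : MvPolynomial (Fin (d + 1)) ℝ}
    (hP : P ∈ polyLE d n) : coneMk d P ∈ conePolyLE d n :=
  Submodule.mem_map_of_mem hP

/-- A polynomial on the cone of degree at most `n` has a representative of degree at most `n` that
is harmonic in `x`. -/
theorem exists_xHarmonic_of_mem_conePolyLE {d : ℕ} (hd : 2 ≤ d) {n : ℤ} {u : ConePoly d}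
    (hu : u ∈ conePolyLE d n) : ∃ P ∈ xHarmonic d, P ∈ polyLE d n ∧ coneMk d P = u := by
  obtain ⟨P, hP, rfl⟩ := hu
  obtain ⟨q, hq, hq'⟩ := exists_xLaplacian_coneQuadric_mul_eq hd (xLaplacian_mem_polyLE hP)
  refine ⟨P - coneQuadric d * q, ?_, sub_mem hP ?_, ?_⟩
  · simp [xHarmonic, hq']
  · simpa using coneQuadric_mul_mem_polyLE hq
  · refine Ideal.Quotient.eq.2 ?_
    rw [Ideal.mem_span_singleton]
    exact ⟨-q, by simp⟩

theorem eq_of_coneMk_eq {d : ℕ} (hd : 2 ≤ d) {P Q : MvPolynomial (Fin (d + 1)) ℝ}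
    (hP : P ∈ xHarmonic d) (hQ : Q ∈ xHarmonic d) (h : coneMk d P = coneMk d Q) : P = Q :=
  congrArg Subtype.val ((xHarmonic_bijective hd).1 (a₁ := ⟨P, hP⟩) (a₂ := ⟨Q, hQ⟩) h)

/-! ### Restriction to the slices `t = s` -/

/-- The substitution `(x, t) ↦ (s x, s)`. -/
def coneSlice (d : ℕ) (s : ℝ) : MvPolynomial (Fin (d + 1)) ℝ →ₐ[ℝ] MvPolynomial (Fin (d + 1)) ℝ :=
  aeval (Fin.snoc (α := fun _ => MvPolynomial (Fin (d + 1)) ℝ)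
    (fun i => C s * X i.castSucc) (C s))

theorem coneSlice_X_castSucc {d : ℕ} (s : ℝ) (i : Fin d) :
    coneSlice d s (X i.castSucc) = C s * X i.castSucc := by
  simp [coneSlice]

theorem coneSlice_X_last {d : ℕ} (s : ℝ) : coneSlice d s (X (Fin.last d)) = C s := by
  simp [coneSlice]

theorem pderiv_castSucc_coneSlice {d : ℕ} (s : ℝ) (i : Fin d)
    (P : MvPolynomial (Fin (d + 1)) ℝ) :
    pderiv i.castSucc (coneSlice d s P) = C s * coneSlice d s (pderiv i.castSucc P) := by
  classical
  induction P using MvPolynomial.induction_on with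
  | C a => simp [coneSlice, algebraMap_eq]
  | add p q hp hq => simp only [map_add, hp, hq, mul_add]
  | mul_X p j hp =>
    rw [map_mul, pderiv_mul, hp, pderiv_mul, map_add, map_mul, map_mul]
    refine Fin.lastCases ?_ (fun j => ?_) j
    · rw [coneSlice_X_last, pderiv_C, pderiv_X_of_ne (Fin.castSucc_lt_last _).ne', map_zero]
      ring
    · rw [coneSlice_X_castSucc, pderiv_C_mul, pderiv_X]
      by_cases h : i = j
      · subst h; simp; ring
      · rw [Pi.single_eq_of_ne (by simpa using Ne.symm h)]; simp; ring

theorem pderiv_last_coneSlice {d : ℕ} (s : ℝ) (P : MvPolynomial (Fin (d + 1)) ℝ) :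
    pderiv (Fin.last d) (coneSlice d s P) = 0 := by
  classical
  induction P using MvPolynomial.induction_on with
  | C a => simp [coneSlice, algebraMap_eq]
  | add p q hp hq => simp only [map_add, hp, hq, add_zero]
  | mul_X p j hp =>
    rw [map_mul, pderiv_mul, hp]
    refine Fin.lastCases ?_ (fun j => ?_) j
    · rw [coneSlice_X_last, pderiv_C]; ring
    · rw [coneSlice_X_castSucc, pderiv_C_mul, pderiv_X_of_ne (Fin.castSucc_lt_last _).ne]; simp

/-- For fixed `s`, a dilation of `x` preserves harmonicity. Questions on the slice `t = s` thus
reduce to harmonic polynomials free of `t`. -/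
theorem coneSlice_mem_xHarmonic {d : ℕ} (s : ℝ) {P : MvPolynomial (Fin (d + 1)) ℝ}
    (hP : P ∈ xHarmonic d) : coneSlice d s P ∈ xHarmonic d := by
  rw [xHarmonic, LinearMap.mem_ker, xLaplacian_apply] at *
  simp only [pderiv_castSucc_coneSlice, pderiv_C_mul]
  rw [← Finset.mul_sum, ← Finset.mul_sum, ← map_sum, hP]
  simp

theorem coneSlice_mem_polyLE {d : ℕ} (s : ℝ) {n : ℤ} {P : MvPolynomial (Fin (d + 1)) ℝ}
    (hP : P ∈ polyLE d n) : coneSlice d s P ∈ polyLE d n := by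
  rw [polyLE, restrictSupport_eq_span] at hP
  induction hP using Submodule.span_induction with
  | zero => simp
  | add p q _ _ hp hq => rw [map_add]; exact add_mem hp hq
  | smul c p _ hp => rw [map_smul]; exact Submodule.smul_mem _ _ hp
  | mem p hp =>
    obtain ⟨m, hm, rfl⟩ := hp
    refine polyLE_mono hm (mem_polyLE_natCast.2 ?_)
    simp only [coneSlice, aeval_monomial, map_one, one_mul]
    refine (totalDegree_finsetProd _ _).trans ?_
    rw [Finsupp.degree_apply]
    refine Finset.sum_le_sum fun i _ => (totalDegree_pow _ _).trans ?_
    refine (Nat.mul_le_mul_left _ (?_ : _ ≤ 1)).trans (mul_one _).le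
    refine Fin.lastCases ?_ (fun j => ?_) i
    · simp
    · simp only [Fin.snoc_castSucc]
      exact (totalDegree_mul _ _).trans (by simp)

theorem eval_coneSlice {d : ℕ} (s : ℝ) (P : MvPolynomial (Fin (d + 1)) ℝ) (x : Fin d → ℝ) (t : ℝ) :
    eval (Fin.snoc x t : Fin (d + 1) → ℝ) (coneSlice d s P) =
      eval (Fin.snoc (fun i => s * x i) s : Fin (d + 1) → ℝ) P := by
  induction P using MvPolynomial.induction_on with
  | C a => simp [coneSlice, algebraMap_eq]
  | add p q hp hq => simp only [map_add, hp, hq]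
  | mul_X p j hp =>
    rw [map_mul, map_mul, hp, map_mul]
    congr 1
    refine Fin.lastCases ?_ (fun j => ?_) j
    · simp [coneSlice_X_last]
    · simp [coneSlice_X_castSucc]

/-- This is the factor theorem in `t`: the difference vanishes at `t = 1`. -/
theorem one_sub_X_last_dvd_sub_coneSlice_one {d : ℕ} (P : MvPolynomial (Fin (d + 1)) ℝ) :
    1 - X (Fin.last d) ∣ P - coneSlice d 1 P := by
  induction P using MvPolynomial.induction_on with
  | C a => simp [coneSlice, algebraMap_eq]
  | add p q hp hq =>
    rw [map_add, add_sub_add_comm]; exact dvd_add hp hq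
  | mul_X p j hp =>
    rw [map_mul]
    refine Fin.lastCases ?_ (fun j => ?_) j
    · rw [coneSlice_X_last, map_one, mul_one]
      rw [show p * X (Fin.last d) - coneSlice d 1 p =
        (p - coneSlice d 1 p) - (1 - X (Fin.last d)) * p by ring]
      exact dvd_sub hp (dvd_mul_right _ _)
    · rw [coneSlice_X_castSucc, map_one, one_mul, ← sub_mul]
      exact hp.mul_right _

theorem coneSlice_one_rename {d : ℕ} (Y : MvPolynomial (Fin d) ℝ) :
    coneSlice d 1 (rename Fin.castSucc Y) = rename Fin.castSucc Y := by
  induction Y using MvPolynomial.induction_on with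
  | C a => simp [coneSlice, algebraMap_eq]
  | add p q hp hq => simp only [map_add, hp, hq]
  | mul_X p j hp => rw [map_mul, rename_X, map_mul, hp, coneSlice_X_castSucc]; simp

/-! ### Solid harmonics -/

theorem coeff_eq_zero_of_pderiv_last_eq_zero {d : ℕ} {P : MvPolynomial (Fin (d + 1)) ℝ}
    (h : pderiv (Fin.last d) P = 0) {m : Fin (d + 1) →₀ ℕ} (hm : coeff m P ≠ 0) :
    m (Fin.last d) = 0 := by
  have h1 := congrArg (coeff m) (X_last_mul_pderiv_last P)
  rw [h, mul_zero, coeff_zero, coeff_diagOp] at h1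
  simpa [hm] using h1.symm

theorem exists_rename_eq_of_pderiv_last_eq_zero {d : ℕ} {P : MvPolynomial (Fin (d + 1)) ℝ}
    (h : pderiv (Fin.last d) P = 0) : ∃ y, rename Fin.castSucc y = P := by
  refine exists_rename_eq_of_vars_subset_range P _ (Fin.castSucc_injective d) fun i hi => ?_
  obtain ⟨m, hm, hi⟩ := (mem_vars_iff_mem_support i).1 hi
  have h0 := coeff_eq_zero_of_pderiv_last_eq_zero h (mem_support_iff.1 hm)
  have hne : i ≠ Fin.last d := by
    rintro rfl
    exact Finsupp.mem_support_iff.1 hi h0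
  exact ⟨i.castPred hne, Fin.castSucc_castPred i hne⟩

theorem xDegree_eq_of_xEuler_eq {d : ℕ} {c : ℕ} {P : MvPolynomial (Fin (d + 1)) ℝ}
    (h : xEuler d P = (c : ℝ) • P) {m : Fin (d + 1) →₀ ℕ} (hm : coeff m P ≠ 0) :
    xDegree m = c := by
  have h1 := congrArg (coeff m) h
  rw [xEuler_eq_diagOp, coeff_diagOp, coeff_smul, smul_eq_mul] at h1
  exact_mod_cast mul_right_cancel₀ hm h1

theorem pderiv_last_rename {d : ℕ} (y : MvPolynomial (Fin d) ℝ) :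
    pderiv (Fin.last d) (rename Fin.castSucc y) = 0 := by
  induction y using MvPolynomial.induction_on with
  | C a => simp
  | add p q hp hq => simp only [map_add, hp, hq, add_zero]
  | mul_X p j hp =>
    rw [map_mul, pderiv_mul, hp, rename_X, pderiv_X_of_ne (Fin.castSucc_lt_last _).ne]
    simp

theorem xLaplacian_rename {d : ℕ} (y : MvPolynomial (Fin d) ℝ) :
    xLaplacian d (rename Fin.castSucc y) = rename Fin.castSucc (∑ i, pderiv i (pderiv i y)) := by
  simp only [xLaplacian_apply, map_sum, pderiv_rename (Fin.castSucc_injective d)]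

theorem mem_solidHarmonic_iff {d n : ℕ} {y : MvPolynomial (Fin d) ℝ} :
    y ∈ solidHarmonic d n ↔ y.IsHomogeneous n ∧ ∑ i, pderiv i (pderiv i y) = 0 := by
  simp [solidHarmonic, LinearMap.sum_apply]

theorem weight_one_eq_degree {σ : Type*} (m : σ →₀ ℕ) :
    Finsupp.weight (1 : σ → ℕ) m = m.degree :=
  (DFunLike.congr_fun Finsupp.degree_eq_weight_one m).symm

/-- A solid harmonic is characterized among harmonic representatives by two eigenvalue conditions:
`∂ₜ` annihilates it and `E` acts as `n`. The proof of the main theorem uses only these. -/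
theorem mem_coneSolidHarmonic_iff {d n : ℕ} {u : ConePoly d} :
    u ∈ coneSolidHarmonic d n ↔ ∃ Y ∈ xHarmonic d, pderiv (Fin.last d) Y = 0 ∧
      xEuler d Y = (n : ℝ) • Y ∧ coneMk d Y = u := by
  constructor
  · rintro ⟨y, hy, rfl⟩
    obtain ⟨h1, h2⟩ := mem_solidHarmonic_iff.1 hy
    refine ⟨rename Fin.castSucc y, ?_, pderiv_last_rename y, ?_, rfl⟩
    · rw [xHarmonic, LinearMap.mem_ker, xLaplacian_rename, h2, map_zero]
    · ext m
      rw [xEuler_eq_diagOp, coeff_diagOp, coeff_smul, smul_eq_mul]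
      by_cases hm : coeff m (rename Fin.castSucc y) = 0
      · simp [hm]
      · have h3 := (IsHomogeneous.rename_isHomogeneous (f := Fin.castSucc) h1) hm
        have h4 := coeff_eq_zero_of_pderiv_last_eq_zero (pderiv_last_rename y) hm
        rw [weight_one_eq_degree, degree_eq_xDegree_add, h4] at h3
        rw [← h3, add_zero]
  · rintro ⟨Y, hY, ht, hE, rfl⟩
    obtain ⟨y, rfl⟩ := exists_rename_eq_of_pderiv_last_eq_zero ht
    refine ⟨y, mem_solidHarmonic_iff.2 ⟨?_, ?_⟩, rfl⟩
    · rw [← IsHomogeneous.rename_isHomogeneous_iff (Fin.castSucc_injective d)]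
      intro m hm
      rw [weight_one_eq_degree, degree_eq_xDegree_add, xDegree_eq_of_xEuler_eq hE hm,
        coeff_eq_zero_of_pderiv_last_eq_zero ht hm, add_zero]
    · rw [xHarmonic, LinearMap.mem_ker, xLaplacian_rename] at hY
      exact (rename_injective _ (Fin.castSucc_injective d)) (hY.trans (map_zero _).symm)

theorem coneSlice_one_eq_self {d : ℕ} {P : MvPolynomial (Fin (d + 1)) ℝ}
    (h : pderiv (Fin.last d) P = 0) : coneSlice d 1 P = P := by
  obtain ⟨y, rfl⟩ := exists_rename_eq_of_pderiv_last_eq_zero h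
  exact coneSlice_one_rename y

/-! ### Moments over the sphere and over the cone -/

theorem coneVal_coneMk_eq_eval {d : ℕ} (ξ : UnitSphere d) (t : ℝ)
    (P : MvPolynomial (Fin (d + 1)) ℝ) : coneVal ξ t (coneMk d P) = eval (conePoint ξ t) P := by
  rw [coneVal_coneMk]; rfl

theorem eval_conePoint_X_last {d : ℕ} (ξ : UnitSphere d) (t : ℝ) :
    eval (conePoint ξ t) (X (Fin.last d)) = t := by
  simp [conePoint]

theorem continuous_eval_conePoint {d : ℕ} (P : MvPolynomial (Fin (d + 1)) ℝ) :
    Continuous fun p : ℝ × UnitSphere d => eval (conePoint p.2 p.1) P := by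
  simpa only [coneVal_coneMk_eq_eval] using continuous_coneVal (coneMk d P)

theorem continuous_eval_conePoint_right {d : ℕ} (t : ℝ) (P : MvPolynomial (Fin (d + 1)) ℝ) :
    Continuous fun ξ : UnitSphere d => eval (conePoint ξ t) P := by
  have h : Continuous fun ξ : UnitSphere d => (t, ξ) := by fun_prop
  have h2 := (continuous_eval_conePoint P).comp h
  simpa only [Function.comp_def] using h2

theorem integrable_eval_conePoint {d : ℕ} (t : ℝ) (P : MvPolynomial (Fin (d + 1)) ℝ) :
    Integrable (fun ξ => eval (conePoint ξ t) P) (sphereMeasure d) :=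
  (continuous_eval_conePoint_right t P).integrable_of_hasCompactSupport
    (HasCompactSupport.of_compactSpace _)

/-- The functional `P ↦ ∫ P(tξ, t) dσ(ξ)`. -/
def sphereMoment (d : ℕ) (t : ℝ) : MvPolynomial (Fin (d + 1)) ℝ →ₗ[ℝ] ℝ where
  toFun P := ∫ ξ, eval (conePoint ξ t) P ∂(sphereMeasure d)
  map_add' P Q := by
    simp only [map_add, integral_add (integrable_eval_conePoint t P)
      (integrable_eval_conePoint t Q)]
  map_smul' c P := by
    simp only [smul_eval, integral_const_mul, RingHom.id_apply, smul_eq_mul]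

theorem sphereMoment_apply {d : ℕ} (t : ℝ) (P : MvPolynomial (Fin (d + 1)) ℝ) :
    sphereMoment d t P = ∫ ξ, eval (conePoint ξ t) P ∂(sphereMeasure d) := rfl

theorem continuous_sphereMoment {d : ℕ} (P : MvPolynomial (Fin (d + 1)) ℝ) :
    Continuous fun t => sphereMoment d t P := by
  have := continuous_parametric_integral_of_continuous (μ := sphereMeasure d)
    (f := fun (t : ℝ) (ξ : UnitSphere d) => eval (conePoint ξ t) P) (continuous_eval_conePoint P)
    (s := Set.univ) isCompact_univ
  simpa [sphereMoment_apply] using this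

/-- The functional `P ↦ ∫₀¹ t^k ∫ P(tξ, t) dσ(ξ) dt`. -/
def coneMoment (d k : ℕ) : MvPolynomial (Fin (d + 1)) ℝ →ₗ[ℝ] ℝ where
  toFun P := ∫ t in (0 : ℝ)..1, t ^ k * sphereMoment d t P
  map_add' P Q := by
    simp only [map_add, mul_add]
    exact intervalIntegral.integral_add
      (((continuous_pow k).mul (continuous_sphereMoment P)).intervalIntegrable _ _)
      (((continuous_pow k).mul (continuous_sphereMoment Q)).intervalIntegrable _ _)
  map_smul' c P := by
    simp only [map_smul, smul_eq_mul, RingHom.id_apply]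
    rw [← intervalIntegral.integral_const_mul]
    congr 1; ext t; ring

theorem coneMoment_apply {d : ℕ} (k : ℕ) (P : MvPolynomial (Fin (d + 1)) ℝ) :
    coneMoment d k P = ∫ t in (0 : ℝ)..1, t ^ k * sphereMoment d t P := rfl

theorem conePoint_eq_smul {d : ℕ} (ξ : UnitSphere d) (t : ℝ) :
    conePoint ξ t = t • conePoint ξ 1 := by
  ext i
  refine Fin.lastCases ?_ (fun j => ?_) i <;> simp [conePoint]

theorem sphereMoment_monomial {d : ℕ} (t : ℝ) (m : Fin (d + 1) →₀ ℕ) (c : ℝ) :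
    sphereMoment d t (monomial m c) = t ^ m.degree * sphereMoment d 1 (monomial m c) := by
  simp only [sphereMoment_apply]
  rw [← integral_const_mul]
  refine integral_congr_ae (Filter.Eventually.of_forall fun ξ => ?_)
  simp only [eval_monomial]
  rw [conePoint_eq_smul ξ t]
  simp only [Finsupp.prod, Pi.smul_apply, smul_eq_mul, mul_pow, Finset.prod_mul_distrib,
    Finset.prod_pow_eq_pow_sum, Finsupp.degree_apply]
  ring

/-- Integration by parts along the rays of the cone. -/
theorem coneMoment_diagOp {d : ℕ} (k : ℕ) (P : MvPolynomial (Fin (d + 1)) ℝ) :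
    coneMoment d k (diagOp d (fun a b => a + b + k + 1) P) = sphereMoment d 1 P := by
  induction P using MvPolynomial.induction_on' with
  | add p q hp hq => simp only [map_add, hp, hq]
  | monomial m c =>
    -- On a monomial of total degree `D` the integrand is a constant times `(D + k + 1) t^(k + D)`,
    -- whose integral over `[0, 1]` is that constant.
    have h : ∀ t : ℝ, t ^ k * sphereMoment d t (monomial m
        (((xDegree m : ℝ) + m (Fin.last d) + k + 1) * c)) =
        t ^ (k + m.degree) * (((xDegree m : ℝ) + m (Fin.last d) + k + 1) *
        sphereMoment d 1 (monomial m c)) := fun t => by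
      rw [← smul_eq_mul _ c, ← smul_monomial, map_smul, sphereMoment_monomial, smul_eq_mul,
        pow_add]
      ring
    rw [diagOp_monomial, coneMoment_apply]
    simp only [h]
    rw [intervalIntegral.integral_mul_const, integral_pow, degree_eq_xDegree_add]
    have h2 : (k : ℝ) + (xDegree m + m (Fin.last d)) + 1 ≠ 0 := by positivity
    rw [one_pow, zero_pow (by omega)]
    push_cast
    field_simp
    ring

theorem coneMoment_X_last_mul {d : ℕ} (k : ℕ) (P : MvPolynomial (Fin (d + 1)) ℝ) :
    coneMoment d k (X (Fin.last d) * P) = coneMoment d (k + 1) P := by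
  simp only [coneMoment_apply, sphereMoment_apply, map_mul, eval_conePoint_X_last,
    integral_const_mul]
  congr 1; ext t
  ring

theorem sphereMoment_one_X_last_mul {d : ℕ} (P : MvPolynomial (Fin (d + 1)) ℝ) :
    sphereMoment d 1 (X (Fin.last d) * P) = sphereMoment d 1 P := by
  simp [sphereMoment_apply, conePoint]

theorem sphereMoment_one_one_sub_X_last_mul {d : ℕ} (P : MvPolynomial (Fin (d + 1)) ℝ) :
    sphereMoment d 1 ((1 - X (Fin.last d)) * P) = 0 := by
  rw [sub_mul, one_mul, map_sub, sphereMoment_one_X_last_mul, sub_self]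

theorem sphereMoment_coneSlice {d : ℕ} (s : ℝ) (P : MvPolynomial (Fin (d + 1)) ℝ) :
    sphereMoment d 1 (coneSlice d s P) = sphereMoment d s P := by
  simp [sphereMoment_apply, conePoint, eval_coneSlice]

/-! ### Positivity and vanishing of moments of squares -/

instance (d : ℕ) : (sphereMeasure d).IsOpenPosMeasure := by
  unfold sphereMeasure; infer_instance

theorem sphereMoment_mul_self_nonneg {d : ℕ} (t : ℝ) (P : MvPolynomial (Fin (d + 1)) ℝ) :
    0 ≤ sphereMoment d t (P * P) :=
  integral_nonneg fun ξ => by simp only [map_mul]; exact mul_self_nonneg _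

theorem eval_conePoint_eq_zero_of_sphereMoment {d : ℕ} {t : ℝ} {P : MvPolynomial (Fin (d + 1)) ℝ}
    (h : sphereMoment d t (P * P) = 0) (ξ : UnitSphere d) : eval (conePoint ξ t) P = 0 := by
  have hc := continuous_eval_conePoint_right t (P * P)
  have hn : 0 ≤ fun ξ : UnitSphere d => eval (conePoint ξ t) (P * P) := fun ξ => by
    simp only [map_mul]; exact mul_self_nonneg _
  have h0 := (integral_eq_zero_iff_of_nonneg hn (integrable_eval_conePoint t (P * P))).1 h
  have h1 := congrFun ((hc.ae_eq_iff_eq (sphereMeasure d) continuous_zero).1 h0) ξ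
  simpa using h1

theorem coneMoment_mul_self_nonneg {d : ℕ} (k : ℕ) (P : MvPolynomial (Fin (d + 1)) ℝ) :
    0 ≤ coneMoment d k (P * P) :=
  intervalIntegral.integral_nonneg zero_le_one fun t ht =>
    mul_nonneg (pow_nonneg ht.1 _) (sphereMoment_mul_self_nonneg t P)

theorem sphereMoment_eq_zero_of_coneMoment {d k : ℕ} {P : MvPolynomial (Fin (d + 1)) ℝ}
    (h : coneMoment d k (P * P) = 0) {t : ℝ} (ht : t ∈ Set.Ioo (0 : ℝ) 1) :
    sphereMoment d t (P * P) = 0 := by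
  by_contra hne
  have hpos : 0 < coneMoment d k (P * P) := by
    refine intervalIntegral.integral_pos zero_lt_one
      ((continuous_pow k).mul (continuous_sphereMoment _)).continuousOn
      (fun s hs => mul_nonneg (pow_nonneg hs.1.le _) (sphereMoment_mul_self_nonneg s P))
      ⟨t, ⟨ht.1.le, ht.2.le⟩, ?_⟩
    exact mul_pos (pow_pos ht.1 _) ((sphereMoment_mul_self_nonneg t P).lt_of_ne (Ne.symm hne))
  exact hpos.ne' h

/-! ### The inner products in terms of moments -/

theorem coneBoundaryIntegral_coneMk {d : ℕ} (P : MvPolynomial (Fin (d + 1)) ℝ) :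
    coneBoundaryIntegral d (coneMk d P) = sphereMoment d 1 P := by
  simp only [coneBoundaryIntegral, sphereMoment_apply, ← coneVal_coneMk_eq_eval]
  rfl

/-- The exponent is a variable `β` with `β = 0` so that the lemma also fits the unevaluated exponent
`-1 + 1` in `sobolevInner`. -/
theorem coneWeightedIntegral_coneMk_zero {d : ℕ} (hd : 2 ≤ d) {β : ℝ} (hβ : β = 0)
    (h1 : -(d : ℝ) < β) (h2 : -1 < (0 : ℝ)) (P : MvPolynomial (Fin (d + 1)) ℝ) :
    coneWeightedIntegral hd h1 h2 (coneMk d P) = coneMoment d (d - 1) P := by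
  subst hβ
  change coneIntegral d (fun ξ t => coneVal ξ t (coneMk d P) * jacobiWeight 0 0 t) = _
  simp [coneIntegral, jacobiWeight, coneVal_coneMk_eq_eval, coneMoment_apply, sphereMoment_apply]

theorem coneWeightedIntegral_coneMk_neg_one_one {d : ℕ} (hd : 2 ≤ d)
    (h1 : -(d : ℝ) < -1) (h2 : -1 < (1 : ℝ)) (P : MvPolynomial (Fin (d + 1)) ℝ) :
    coneWeightedIntegral hd h1 h2 (coneMk d P) =
      coneMoment d (d - 2) ((1 - X (Fin.last d)) * P) := by
  change coneIntegral d (fun ξ t => coneVal ξ t (coneMk d P) * jacobiWeight (-1) 1 t) = _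
  rw [coneIntegral, coneMoment_apply, intervalIntegral.integral_of_le zero_le_one,
    intervalIntegral.integral_of_le zero_le_one]
  -- On `(0, 1]` the singular factor is absorbed as `t^(d-1) · t⁻¹ = t^(d-2)`, with natural exponent
  -- since `d ≥ 2`; the point `t = 0` is excluded.
  refine setIntegral_congr_fun measurableSet_Ioc fun t ht => ?_
  have h3 : d - 1 = d - 2 + 1 := by omega
  simp only [jacobiWeight, coneVal_coneMk_eq_eval, sphereMoment_apply, map_mul]
  rw [integral_mul_const, Real.rpow_neg_one, Real.rpow_one, h3, pow_succ]
  have h4 : ∀ ξ : UnitSphere d, eval (conePoint ξ t) (1 - X (Fin.last d)) = 1 - t := fun ξ => by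
    simp [conePoint]
  simp only [h4, integral_const_mul]
  have := ht.1.ne'
  field_simp

theorem sphereArea_pos {d : ℕ} (hd : 2 ≤ d) : 0 < sphereArea d := by
  have : Nontrivial (EuclideanSpace ℝ (Fin d)) := by
    have : Nonempty (Fin d) := ⟨⟨0, by omega⟩⟩
    infer_instance
  have h : sphereMeasure d ≠ 0 := by
    unfold sphereMeasure; exact Measure.toSphere_ne_zero _
  rw [sphereArea, Measure.real, ENNReal.toReal_pos_iff]
  exact ⟨by simpa [pos_iff_ne_zero] using h, measure_lt_top _ _⟩

theorem coneNorm_neg_one_one_pos {d : ℕ} (hd : 2 ≤ d) : 0 < coneNorm d (-1) 1 := by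
  have h : (2 : ℝ) ≤ d := by exact_mod_cast hd
  have := sphereArea_pos hd
  rw [coneNorm]
  have h1 := Real.Gamma_pos_of_pos (show (0 : ℝ) < -1 + 1 + d + 1 by linarith)
  have h2 := Real.Gamma_pos_of_pos (show (0 : ℝ) < -1 + d by linarith)
  have h3 := Real.Gamma_pos_of_pos (show (0 : ℝ) < 1 + 1 by linarith)
  positivity

theorem jacobiInner_coneMk {d : ℕ} (hd : 2 ≤ d) (h1 : -(d : ℝ) < -1) (h2 : -1 < (1 : ℝ))
    (P Q : MvPolynomial (Fin (d + 1)) ℝ) :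
    jacobiInner hd (-1) 1 h1 h2 (coneMk d P) (coneMk d Q) =
      coneNorm d (-1) 1 * coneMoment d (d - 2) ((1 - X (Fin.last d)) * (P * Q)) := by
  rw [← coneWeightedIntegral_coneMk_neg_one_one hd h1 h2, map_mul]
  simp [jacobiInner]

theorem sobolevInner_coneMk {d : ℕ} (hd : 2 ≤ d) (h1 : -(d : ℝ) < -1 + 1) (lam : ℝ)
    {P Q : MvPolynomial (Fin (d + 1)) ℝ} (hP : P ∈ xHarmonic d) (hQ : Q ∈ xHarmonic d) :
    sobolevInner hd (-1) h1 lam (coneMk d P) (coneMk d Q) =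
      (sphereArea d)⁻¹ * (coneMoment d (d - 1) (pderiv (Fin.last d) P * pderiv (Fin.last d) Q) +
        lam * sphereMoment d 1 (P * Q)) := by
  rw [← coneWeightedIntegral_coneMk_zero hd (by norm_num) h1 (by norm_num),
    ← coneBoundaryIntegral_coneMk, map_mul (coneMk d), map_mul (coneMk d),
    ← coneDt_coneMk hd hP, ← coneDt_coneMk hd hQ]
  simp [sobolevInner]
  ring

/-! ### Orthogonality of harmonic polynomials of different degrees on the sphere -/

theorem hasDerivAt_eval {σ : Type*} [Fintype σ] {γ : ℝ → σ → ℝ} {γ' : σ → ℝ} {t : ℝ}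
    (h : ∀ i, HasDerivAt (fun s => γ s i) (γ' i) t) (P : MvPolynomial σ ℝ) :
    HasDerivAt (fun s => eval (γ s) P) (∑ i, γ' i * eval (γ t) (pderiv i P)) t := by
  classical
  induction P using MvPolynomial.induction_on with
  | C a => simpa using hasDerivAt_const t a
  | add p q hp hq =>
    simp only [map_add, mul_add, Finset.sum_add_distrib]
    exact hp.add hq
  | mul_X p j hp =>
    simp only [map_mul, eval_X, pderiv_mul, map_add, pderiv_X]
    refine (hp.mul (h j)).congr_deriv ?_
    simp only [mul_add, Finset.sum_add_distrib]
    congr 1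
    · rw [Finset.sum_mul]
      exact Finset.sum_congr rfl fun i _ => by ring
    · rw [Finset.sum_eq_single j]
      · simp; ring
      · intro i _ hi
        rw [Pi.single_eq_of_ne (Ne.symm hi)]; simp
      · simp

theorem xEuler_mul {d : ℕ} (P Q : MvPolynomial (Fin (d + 1)) ℝ) :
    xEuler d (P * Q) = xEuler d P * Q + P * xEuler d Q := by
  simp only [xEuler, pderiv_mul, Finset.sum_mul, Finset.mul_sum, ← Finset.sum_add_distrib]
  exact Finset.sum_congr rfl fun i _ => by ring

/-! ### Gaussian integration by parts and polar coordinates -/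

/-- The value of a polynomial at the point `(y, s)`. -/
def sliceEval {d : ℕ} (s : ℝ) (P : MvPolynomial (Fin (d + 1)) ℝ) (y : EuclideanSpace ℝ (Fin d)) :
    ℝ :=
  eval (Fin.snoc (fun i => y i) s : Fin (d + 1) → ℝ) P

theorem sliceEval_smul {d k : ℕ} {P : MvPolynomial (Fin (d + 1)) ℝ}
    (hP : xEuler d P = (k : ℝ) • P) (s r : ℝ) (y : EuclideanSpace ℝ (Fin d)) :
    sliceEval s P (r • y) = r ^ k * sliceEval s P y := by
  simp only [sliceEval, eval_eq', Finset.mul_sum]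
  refine Finset.sum_congr rfl fun m hm => ?_
  rw [← xDegree_eq_of_xEuler_eq hP (mem_support_iff.1 hm), xDegree]
  simp only [Fin.prod_univ_castSucc, Fin.snoc_castSucc, Fin.snoc_last, PiLp.smul_apply,
    smul_eq_mul, mul_pow, Finset.prod_mul_distrib, Finset.prod_pow_eq_pow_sum]
  ring

theorem hasLineDerivAt_sliceEval {d : ℕ} (s : ℝ) (P : MvPolynomial (Fin (d + 1)) ℝ) (i : Fin d)
    (y : EuclideanSpace ℝ (Fin d)) :
    HasLineDerivAt ℝ (sliceEval s P) (sliceEval s (pderiv i.castSucc P) y) y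
      (EuclideanSpace.single i 1) := by
  classical
  have h := hasDerivAt_eval (t := (0 : ℝ)) (γ := fun r => (Fin.snoc
    (fun j => (y + r • EuclideanSpace.single i (1 : ℝ)) j) s : Fin (d + 1) → ℝ))
    (γ' := Pi.single i.castSucc 1) (fun k => ?_) P
  · refine h.congr_deriv ?_
    rw [Finset.sum_eq_single i.castSucc]
    · simp [sliceEval]
    · intro b _ hb; rw [Pi.single_eq_of_ne hb, zero_mul]
    · simp
  · refine Fin.lastCases ?_ (fun j => ?_) k
    · simpa [Pi.single_apply, (Fin.castSucc_lt_last _).ne'] using hasDerivAt_const (0 : ℝ) s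
    · simp only [Fin.snoc_castSucc, PiLp.add_apply, PiLp.smul_apply, smul_eq_mul,
        PiLp.single_apply, Pi.single_apply, Fin.castSucc_inj]
      simpa using ((hasDerivAt_id (0 : ℝ)).mul_const (if j = i then (1 : ℝ) else 0)).const_add (y j)

theorem hasLineDerivAt_gaussian {d : ℕ} (i : Fin d) (y : EuclideanSpace ℝ (Fin d)) :
    HasLineDerivAt ℝ (fun y : EuclideanSpace ℝ (Fin d) => Real.exp (-(1 / 2) * ‖y‖ ^ 2))
      (-(y i * Real.exp (-(1 / 2) * ‖y‖ ^ 2))) y (EuclideanSpace.single i 1) := by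
  have h := (((hasStrictFDerivAt_norm_sq y).hasFDerivAt.const_mul (-(1 / 2))).exp).hasLineDerivAt
    (EuclideanSpace.single i 1)
  have e : (Real.exp (-(1 / 2) * ‖y‖ ^ 2) • (-(1 / 2) : ℝ) • 2 • (innerSL ℝ) y)
      (EuclideanSpace.single i 1) = -(y i * Real.exp (-(1 / 2) * ‖y‖ ^ 2)) := by
    simp [EuclideanSpace.inner_single_right]
    ring
  rw [e] at h
  exact h

theorem integrable_sliceEval_mul_gaussian {d : ℕ} (s : ℝ) (P : MvPolynomial (Fin (d + 1)) ℝ) :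
    Integrable (fun y : EuclideanSpace ℝ (Fin d) =>
      sliceEval s P y * Real.exp (-(1 / 2) * ‖y‖ ^ 2)) := by
  induction P using MvPolynomial.induction_on' with
  | add p q hp hq =>
    refine (hp.add hq).congr (Filter.Eventually.of_forall fun y => ?_)
    simp only [sliceEval, map_add, Pi.add_apply]
    ring
  | monomial m c =>
    have h1 : ∀ k : ℕ, Integrable fun x : ℝ => x ^ k * Real.exp (-(1 / 2) * x ^ 2) := fun k => by
      have := integrable_rpow_mul_exp_neg_mul_sq (b := 1 / 2) (by norm_num)
        (s := (k : ℝ)) (by linarith [(Nat.cast_nonneg k : (0 : ℝ) ≤ k)])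
      simpa only [Real.rpow_natCast] using this
    have h2 : Integrable fun y : Fin d → ℝ =>
        ∏ i : Fin d, (y i ^ m i.castSucc * Real.exp (-(1 / 2) * y i ^ 2)) := by
      rw [volume_pi]
      exact Integrable.fintype_prod (μ := fun _ : Fin d => (volume : Measure ℝ))
        (f := fun i x => x ^ m i.castSucc * Real.exp (-(1 / 2) * x ^ 2)) fun i => h1 (m i.castSucc)
    have hv := EuclideanSpace.volume_preserving_symm_measurableEquiv_toLp (Fin d)
    have h3 := (hv.integrable_comp_emb (MeasurableEquiv.measurableEmbedding _)
      (g := fun y : Fin d → ℝ =>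
        ∏ i : Fin d, (y i ^ m i.castSucc * Real.exp (-(1 / 2) * y i ^ 2)))).2 h2
    refine (h3.const_mul (c * s ^ m (Fin.last d))).congr (Filter.Eventually.of_forall fun y => ?_)
    simp only [sliceEval, eval_monomial, Finsupp.prod_fintype _ _ (fun i => pow_zero _),
      Fin.prod_univ_castSucc, Fin.snoc_castSucc, Fin.snoc_last, EuclideanSpace.real_norm_sq_eq,
      Finset.mul_sum, Real.exp_sum, Function.comp_apply, Finset.prod_mul_distrib]
    simp
    ring

/-- The functional `P ↦ ∫ P(y, s) exp(-‖y‖² / 2) dy`. -/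
def gaussianMoment (d : ℕ) (s : ℝ) : MvPolynomial (Fin (d + 1)) ℝ →ₗ[ℝ] ℝ where
  toFun P := ∫ y : EuclideanSpace ℝ (Fin d), sliceEval s P y * Real.exp (-(1 / 2) * ‖y‖ ^ 2)
  map_add' P Q := by
    rw [← integral_add (integrable_sliceEval_mul_gaussian s P)
      (integrable_sliceEval_mul_gaussian s Q)]
    simp only [sliceEval, map_add, add_mul]
  map_smul' c P := by
    simp only [sliceEval, smul_eval, RingHom.id_apply, smul_eq_mul, ← integral_const_mul, mul_assoc]

theorem gaussianMoment_apply {d : ℕ} (s : ℝ) (P : MvPolynomial (Fin (d + 1)) ℝ) :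
    gaussianMoment d s P =
      ∫ y : EuclideanSpace ℝ (Fin d), sliceEval s P y * Real.exp (-(1 / 2) * ‖y‖ ^ 2) := rfl

/-- Integration by parts: `∂ᵢ` of the Gaussian is `-yᵢ` times the Gaussian, and there is no boundary
term. -/
theorem gaussianMoment_pderiv {d : ℕ} (s : ℝ) (i : Fin d) (P : MvPolynomial (Fin (d + 1)) ℝ) :
    gaussianMoment d s (pderiv i.castSucc P) = gaussianMoment d s (X i.castSucc * P) := by
  have hX : ∀ y : EuclideanSpace ℝ (Fin d), sliceEval s (X i.castSucc * P) y =
      y i * sliceEval s P y := fun y => by simp [sliceEval]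
  have hi := integrable_sliceEval_mul_gaussian s (X i.castSucc * P)
  simp only [hX] at hi
  have h := integral_bilinear_hasLineDerivAt_right_eq_neg_left_of_integrable
    (B := ContinuousLinearMap.mul ℝ ℝ) (v := EuclideanSpace.single i (1 : ℝ))
    (μ := (volume : Measure (EuclideanSpace ℝ (Fin d))))
    (f := sliceEval s P) (f' := sliceEval s (pderiv i.castSucc P))
    (g := fun y => Real.exp (-(1 / 2) * ‖y‖ ^ 2))
    (g' := fun y => -(y i * Real.exp (-(1 / 2) * ‖y‖ ^ 2)))
    (integrable_sliceEval_mul_gaussian s _)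
    (hi.neg.congr (Filter.Eventually.of_forall fun y => by simp; ring))
    (integrable_sliceEval_mul_gaussian s _)
    (fun y _ => hasLineDerivAt_sliceEval s P i y) (fun y _ => hasLineDerivAt_gaussian i y)
  rw [gaussianMoment_apply, gaussianMoment_apply]
  simp only [hX]
  simp only [ContinuousLinearMap.mul_apply', mul_neg, integral_neg, neg_inj] at h
  rw [← h]
  congr 1; ext y; ring

/-- Integration by parts turns `∫ A · EB` into `∫ (∇A · ∇B + A ΔB)`; for harmonic `B` only the
symmetric first term remains. The Gaussian integral over the whole space plays the role of Green's
formula on the ball. -/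
theorem gaussianMoment_xEuler_mul {d : ℕ} (s : ℝ) {P Q : MvPolynomial (Fin (d + 1)) ℝ}
    (hP : P ∈ xHarmonic d) (hQ : Q ∈ xHarmonic d) :
    gaussianMoment d s (xEuler d P * Q) = gaussianMoment d s (P * xEuler d Q) := by
  have key : ∀ {A B : MvPolynomial (Fin (d + 1)) ℝ}, B ∈ xHarmonic d →
      gaussianMoment d s (A * xEuler d B) =
        gaussianMoment d s (∑ i : Fin d, pderiv i.castSucc A * pderiv i.castSucc B) := by
    intro A B hB
    rw [xHarmonic, LinearMap.mem_ker, xLaplacian_apply] at hB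
    rw [xEuler, Finset.mul_sum, map_sum]
    have h : ∀ i : Fin d, gaussianMoment d s (A * (X i.castSucc * pderiv i.castSucc B)) =
        gaussianMoment d s (pderiv i.castSucc A * pderiv i.castSucc B) +
          gaussianMoment d s (A * pderiv i.castSucc (pderiv i.castSucc B)) := fun i => by
      rw [mul_left_comm, ← gaussianMoment_pderiv, pderiv_mul, map_add]
    simp only [h, Finset.sum_add_distrib, ← map_sum, ← Finset.mul_sum, hB]
    simp
  rw [key hQ, mul_comm, key hP]
  simp only [mul_comm]

/-- For `P` homogeneous in `x`, polar coordinates split the Gaussian integral into the integral over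
the sphere times a radial factor, and that factor is nonzero because it is a positive Gamma value.
-/
theorem integral_sphere_eq_zero_of_gaussianMoment {d k : ℕ} (hd : 2 ≤ d) {s : ℝ}
    {P : MvPolynomial (Fin (d + 1)) ℝ} (hP : xEuler d P = (k : ℝ) • P)
    (h : gaussianMoment d s P = 0) :
    ∫ ξ : UnitSphere d, sliceEval s P ξ ∂(sphereMeasure d) = 0 := by
  have : Nontrivial (EuclideanSpace ℝ (Fin d)) := by
    have : Nonempty (Fin d) := ⟨⟨0, by omega⟩⟩
    infer_instance
  let μ : Measure (EuclideanSpace ℝ (Fin d)) := volume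
  let g : ℝ → ℝ := fun r => r ^ k * Real.exp (-(1 / 2) * r ^ 2)
  have h1 : gaussianMoment d s P = (∫ ξ : UnitSphere d, sliceEval s P ξ ∂(sphereMeasure d)) *
      ∫ r : Set.Ioi (0 : ℝ), g r ∂(Measure.volumeIoiPow (d - 1)) := by
    calc gaussianMoment d s P
        = ∫ x : ({0}ᶜ : Set (EuclideanSpace ℝ (Fin d))),
            sliceEval s P x.1 * Real.exp (-(1 / 2) * ‖x.1‖ ^ 2) ∂(μ.comap (↑)) := by
          rw [integral_subtype_comap (measurableSet_singleton _).compl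
            fun x => sliceEval s P x * Real.exp (-(1 / 2) * ‖x‖ ^ 2), restrict_compl_singleton]
          rfl
      _ = ∫ p, sliceEval s P p.1 * g p.2 ∂(μ.toSphere.prod (.volumeIoiPow
            (Module.finrank ℝ (EuclideanSpace ℝ (Fin d)) - 1))) := by
          rw [← μ.measurePreserving_homeomorphUnitSphereProd.integral_comp
            (Homeomorph.measurableEmbedding _)]
          congr 1; ext x
          have hx : ‖x.1‖ ≠ 0 := norm_ne_zero_iff.2 x.2
          have e : sliceEval s P x.1 = ‖x.1‖ ^ k * sliceEval s P (‖x.1‖⁻¹ • x.1) := by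
            rw [← sliceEval_smul hP, smul_inv_smul₀ hx]
          simp only [homeomorphUnitSphereProd_apply_fst_coe,
            homeomorphUnitSphereProd_apply_snd_coe, g]
          rw [e]; ring
      _ = _ := by
          rw [integral_prod_mul (fun ξ : UnitSphere d => sliceEval s P ξ)
            (fun r : Set.Ioi (0 : ℝ) => g r), finrank_euclideanSpace_fin]
          rfl
  have h2 : ∫ r : Set.Ioi (0 : ℝ), g r ∂(Measure.volumeIoiPow (d - 1)) ≠ 0 := by
    have e : ∫ r : Set.Ioi (0 : ℝ), g r ∂(Measure.volumeIoiPow (d - 1)) =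
        ∫ r in Set.Ioi (0 : ℝ), r ^ ((d - 1 + k : ℕ) : ℝ) * Real.exp (-(1 / 2) * r ^ (2 : ℝ)) := by
      simp only [Measure.volumeIoiPow, ENNReal.ofReal]
      rw [integral_withDensity_eq_integral_smul,
        integral_subtype_comap measurableSet_Ioi fun a ↦ Real.toNNReal (a ^ (d - 1)) • g a]
      · refine setIntegral_congr_fun measurableSet_Ioi fun x hx => ?_
        simp only [NNReal.smul_def, Real.coe_toNNReal _ (pow_nonneg (Set.mem_Ioi.1 hx).le _), g,
          smul_eq_mul, Real.rpow_natCast, pow_add, Real.rpow_two, mul_assoc]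
      · exact (measurable_subtype_coe.pow_const _).real_toNNReal
    have hk : (0 : ℝ) ≤ ((d - 1 + k : ℕ) : ℝ) := Nat.cast_nonneg _
    rw [e, integral_rpow_mul_exp_neg_mul_rpow (by norm_num) (by linarith) (by norm_num)]
    have := Real.Gamma_pos_of_pos (show 0 < (((d - 1 + k : ℕ) : ℝ) + 1) / 2 by positivity)
    positivity
  rw [h1] at h
  exact (mul_eq_zero.1 h).resolve_right h2

/-- Eigenvectors of the symmetric operator `E` for different eigenvalues are orthogonal in the
Gaussian form, and homogeneity transfers this to the sphere. -/
theorem sphereMoment_mul_eq_zero {d a b : ℕ} (hd : 2 ≤ d) (t : ℝ) (hab : a ≠ b)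
    {P Q : MvPolynomial (Fin (d + 1)) ℝ} (hP : P ∈ xHarmonic d) (hQ : Q ∈ xHarmonic d)
    (hPa : xEuler d P = (a : ℝ) • P) (hQb : xEuler d Q = (b : ℝ) • Q) :
    sphereMoment d t (P * Q) = 0 := by
  have hE : xEuler d (P * Q) = ((a + b : ℕ) : ℝ) • (P * Q) := by
    rw [xEuler_mul, hPa, hQb, smul_mul_assoc, mul_smul_comm, ← add_smul, Nat.cast_add]
  have h1 : gaussianMoment d t (P * Q) = 0 := by
    have h := gaussianMoment_xEuler_mul t hP hQ
    rw [hPa, hQb, smul_mul_assoc, mul_smul_comm, map_smul, map_smul, smul_eq_mul, smul_eq_mul] at h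
    have hne : (a : ℝ) - b ≠ 0 := sub_ne_zero.2 (by exact_mod_cast hab)
    have : ((a : ℝ) - b) * gaussianMoment d t (P * Q) = 0 := by linarith
    exact (mul_eq_zero.1 this).resolve_left hne
  have h2 := integral_sphere_eq_zero_of_gaussianMoment hd hE h1
  -- Only `x` is scaled here; the last coordinate stays frozen at `t`.
  have h3 : ∀ ξ : UnitSphere d, eval (conePoint ξ t) (P * Q) =
      t ^ (a + b) * sliceEval t (P * Q) ξ := fun ξ => by
    rw [← sliceEval_smul hE]; rfl
  simp only [sphereMoment_apply, h3, integral_const_mul, h2, mul_zero]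

/-! ### Symmetry of the Euler operator on the sphere -/

/-- The component of degree `a` in `x`. -/
def xComponent (d a : ℕ) : MvPolynomial (Fin (d + 1)) ℝ →ₗ[ℝ] MvPolynomial (Fin (d + 1)) ℝ :=
  diagOp d fun a' _ => if a' = a then 1 else 0

theorem xEuler_xComponent {d a : ℕ} (P : MvPolynomial (Fin (d + 1)) ℝ) :
    xEuler d (xComponent d a P) = (a : ℝ) • xComponent d a P := by
  ext m
  rw [xEuler_eq_diagOp, xComponent, diagOp_diagOp, coeff_smul, coeff_diagOp, coeff_diagOp,
    smul_eq_mul]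
  split_ifs with h
  · rw [h]; ring
  · ring

theorem xComponent_mem_xHarmonic {d : ℕ} (a : ℕ) {P : MvPolynomial (Fin (d + 1)) ℝ}
    (hP : P ∈ xHarmonic d) : xComponent d a P ∈ xHarmonic d :=
  diagOp_mem_xHarmonic _ hP

theorem sum_xComponent {d N : ℕ} {P : MvPolynomial (Fin (d + 1)) ℝ}
    (hN : ∀ m, coeff m P ≠ 0 → xDegree m < N) : ∑ a ∈ Finset.range N, xComponent d a P = P := by
  ext m
  simp only [coeff_sum, xComponent, coeff_diagOp]
  by_cases hm : coeff m P = 0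
  · simp [hm]
  · rw [← Finset.sum_mul, Finset.sum_ite_eq, if_pos (Finset.mem_range.2 (hN m hm)), one_mul]

/-- The Euler operator is symmetric on harmonic polynomials with respect to the inner product of
`L²(S^{d-1})`. -/
theorem sphereMoment_xEuler_mul {d : ℕ} (hd : 2 ≤ d) (t : ℝ) {P Q : MvPolynomial (Fin (d + 1)) ℝ}
    (hP : P ∈ xHarmonic d) (hQ : Q ∈ xHarmonic d) :
    sphereMoment d t (xEuler d P * Q) = sphereMoment d t (P * xEuler d Q) := by
  have hN : ∀ R : MvPolynomial (Fin (d + 1)) ℝ, ∀ m, coeff m R ≠ 0 →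
      xDegree m < R.totalDegree + 1 := fun R m hm => by
    have := mem_polyLE.1 (mem_polyLE_natCast.2 (le_refl R.totalDegree)) m hm
    rw [degree_eq_xDegree_add] at this
    omega
  have hE : ∀ R : MvPolynomial (Fin (d + 1)) ℝ,
      ∑ a ∈ Finset.range (R.totalDegree + 1), (a : ℝ) • xComponent d a R = xEuler d R := fun R => by
    conv_rhs => rw [← sum_xComponent (hN R)]
    simp only [xEuler_eq_diagOp, map_sum]
    simp only [← xEuler_eq_diagOp, xEuler_xComponent]
  rw [← hE P, ← hE Q]
  conv_lhs => rw [← sum_xComponent (hN Q)]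
  conv_rhs => enter [2, 1]; rw [← sum_xComponent (hN P)]
  simp only [Finset.sum_mul, Finset.mul_sum, map_sum, smul_mul_assoc, mul_smul_comm, map_smul,
    Finset.smul_sum]
  refine Finset.sum_congr rfl fun a _ => Finset.sum_congr rfl fun b _ => ?_
  -- After expansion into components, terms of different degrees vanish on both sides and those of
  -- equal degree carry the same factor.
  by_cases hab : b = a
  · rw [hab]
  · rw [sphereMoment_mul_eq_zero hd t hab (xComponent_mem_xHarmonic b hP)
      (xComponent_mem_xHarmonic a hQ) (xEuler_xComponent P) (xEuler_xComponent Q)]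
    simp

theorem coneMoment_xEuler_mul {d : ℕ} (hd : 2 ≤ d) (k : ℕ) {P Q : MvPolynomial (Fin (d + 1)) ℝ}
    (hP : P ∈ xHarmonic d) (hQ : Q ∈ xHarmonic d) :
    coneMoment d k (xEuler d P * Q) = coneMoment d k (P * xEuler d Q) := by
  simp only [coneMoment_apply, sphereMoment_xEuler_mul hd _ hP hQ]

/-! ### Uniqueness of harmonic polynomials -/

theorem pderiv_last_xEuler {d : ℕ} (P : MvPolynomial (Fin (d + 1)) ℝ) :
    pderiv (Fin.last d) (xEuler d P) = xEuler d (pderiv (Fin.last d) P) := by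
  rw [xEuler_eq_diagOp, xEuler_eq_diagOp, pderiv_last_diagOp]

theorem xEuler_mem_xHarmonic {d : ℕ} {P : MvPolynomial (Fin (d + 1)) ℝ} (hP : P ∈ xHarmonic d) :
    xEuler d P ∈ xHarmonic d := by
  rw [xEuler_eq_diagOp]; exact diagOp_mem_xHarmonic _ hP

/-- On polynomials of degree below `n` the operator `n - E` is invertible, so `W = (n - E)V`. By
symmetry `n - E` moves to `Y`, which it annihilates. -/
theorem sphereMoment_mul_eq_zero_of_mem_polyLE {d : ℕ} (hd : 2 ≤ d) {n : ℕ} (t : ℝ)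
    {Y W : MvPolynomial (Fin (d + 1)) ℝ} (hY : Y ∈ xHarmonic d) (hE : xEuler d Y = (n : ℝ) • Y)
    (hW : W ∈ xHarmonic d) (hn : W ∈ polyLE d (n - 1)) : sphereMoment d t (Y * W) = 0 := by
  -- The value `0⁻¹ = 0` at `a = n` never matters, since all monomials of `W` have `x`-degree less
  -- than `n`.
  let V := diagOp d (fun a _ => ((n : ℝ) - a)⁻¹) W
  have hV : V ∈ xHarmonic d := diagOp_mem_xHarmonic _ hW
  have hWV : W = (n : ℝ) • V - xEuler d V := by
    rw [xEuler_eq_diagOp, ← diagOp_const, ← diagOp_sub, diagOp_diagOp]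
    refine (diagOp_eq_self fun m hm => mul_inv_cancel₀ (sub_ne_zero.2 ?_)).symm
    have := mem_polyLE.1 hn m hm
    rw [degree_eq_xDegree_add] at this
    push_cast at this
    have h : xDegree m ≠ n := by omega
    exact_mod_cast h.symm
  rw [hWV, mul_sub, map_sub, ← sphereMoment_xEuler_mul hd t hY hV, hE, smul_mul_assoc,
    mul_smul_comm, sub_self]

/-- The homogeneous component of degree `n`. -/
def topComponent (d n : ℕ) : MvPolynomial (Fin (d + 1)) ℝ →ₗ[ℝ] MvPolynomial (Fin (d + 1)) ℝ :=
  diagOp d fun a b => if a + b = n then 1 else 0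

theorem pderiv_last_topComponent {d n : ℕ} {P : MvPolynomial (Fin (d + 1)) ℝ}
    (h : pderiv (Fin.last d) P = 0) : pderiv (Fin.last d) (topComponent d n P) = 0 := by
  rw [topComponent, pderiv_last_diagOp, h, map_zero]

theorem topComponent_mem_xHarmonic {d n : ℕ} {P : MvPolynomial (Fin (d + 1)) ℝ}
    (h : P ∈ xHarmonic d) : topComponent d n P ∈ xHarmonic d :=
  diagOp_mem_xHarmonic _ h

theorem xEuler_topComponent {d n : ℕ} {P : MvPolynomial (Fin (d + 1)) ℝ}
    (h : pderiv (Fin.last d) P = 0) :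
    xEuler d (topComponent d n P) = (n : ℝ) • topComponent d n P := by
  ext m
  rw [xEuler_eq_diagOp, coeff_diagOp, coeff_smul, smul_eq_mul, topComponent, coeff_diagOp]
  by_cases hm : coeff m P = 0
  · simp [hm]
  · rw [coeff_eq_zero_of_pderiv_last_eq_zero h hm]
    split_ifs with h1
    · rw [← h1]; simp
    · simp

theorem sub_topComponent_mem_polyLE {d n : ℕ} {P : MvPolynomial (Fin (d + 1)) ℝ}
    (h : P ∈ polyLE d n) : P - topComponent d n P ∈ polyLE d (n - 1) := by
  have : P - topComponent d n P = diagOp d (fun a b => 1 - if a + b = n then 1 else 0) P := by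
    rw [diagOp_sub, diagOp_const, one_smul, topComponent]
  rw [this]
  refine diagOp_mem_polyLE_sub_one (fun a b hab => ?_) h
  rw [if_pos (by exact_mod_cast hab), sub_self]

/-- `Y` vanishes on the unit sphere, hence by homogeneity on all of `ℝ^d`; it does not involve `t`.
Harmonicity is not used. -/
theorem eq_zero_of_sphereMoment_of_xEuler {d : ℕ} (hd : 2 ≤ d) {n : ℕ}
    {Y : MvPolynomial (Fin (d + 1)) ℝ} (ht : pderiv (Fin.last d) Y = 0)
    (hE : xEuler d Y = (n : ℝ) • Y) (h : sphereMoment d 1 (Y * Y) = 0) : Y = 0 := by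
  have hne : Nontrivial (EuclideanSpace ℝ (Fin d)) := by
    have : Nonempty (Fin d) := ⟨⟨0, by omega⟩⟩
    infer_instance
  have h1 : ∀ x : EuclideanSpace ℝ (Fin d), sliceEval 1 Y x = 0 := by
    intro x
    obtain ⟨ξ, hξ⟩ : ∃ ξ : UnitSphere d, x = ‖x‖ • ξ.1 := by
      by_cases hx : x = 0
      · obtain ⟨ξ, hξ⟩ := (NormedSpace.sphere_nonempty (E := EuclideanSpace ℝ (Fin d)) (x := 0)
          (r := 1)).2 zero_le_one
        exact ⟨⟨ξ, hξ⟩, by simp [hx]⟩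
      · exact ⟨⟨‖x‖⁻¹ • x, by simp [norm_smul, hx]⟩, by
          rw [smul_inv_smul₀ (norm_ne_zero_iff.2 hx)]⟩
    have h2 := eval_conePoint_eq_zero_of_sphereMoment h ξ
    rw [hξ, sliceEval_smul hE]
    simp only [conePoint, one_mul] at h2
    rw [sliceEval, h2, mul_zero]
  refine MvPolynomial.funext fun y => ?_
  have h3 := eval_coneSlice 1 Y (Fin.init y) (y (Fin.last d))
  rw [coneSlice_one_eq_self ht, Fin.snoc_init_self (α := fun _ => ℝ)] at h3
  rw [h3, map_zero]
  simpa [sliceEval] using h1 (WithLp.toLp 2 (Fin.init y : Fin d → ℝ))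

/-- A harmonic polynomial in `x` that vanishes on the unit sphere is zero. -/
theorem eq_zero_of_sphereMoment {d : ℕ} (hd : 2 ≤ d) {W : MvPolynomial (Fin (d + 1)) ℝ}
    (hW : W ∈ xHarmonic d) (ht : pderiv (Fin.last d) W = 0) (h : sphereMoment d 1 (W * W) = 0) :
    W = 0 := by
  have key : ∀ n : ℕ, ∀ W ∈ xHarmonic d, W ∈ polyLE d (n - 1) → pderiv (Fin.last d) W = 0 →
      sphereMoment d 1 (W * W) = 0 → W = 0 := by
    intro n
    induction n with
    | zero => exact fun W _ hn _ _ => eq_zero_of_mem_polyLE_neg (by simp) hn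
    | succ n ih =>
      intro W hW hn ht h
      rw [Nat.cast_succ, add_sub_cancel_right] at hn
      set Y := topComponent d n W with hYdef
      have hY : Y ∈ xHarmonic d := topComponent_mem_xHarmonic hW
      have hV : W - Y ∈ xHarmonic d := sub_mem hW hY
      have hVn : W - Y ∈ polyLE d (n - 1) := sub_topComponent_mem_polyLE hn
      have hYt : pderiv (Fin.last d) Y = 0 := pderiv_last_topComponent ht
      have hYE := xEuler_topComponent (n := n) ht
      have h0 := sphereMoment_mul_eq_zero_of_mem_polyLE hd 1 hY hYE hV hVn
      -- Pythagoras: the top component is orthogonal to the rest, so both squared norms vanish. The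
      -- rest has smaller degree and falls under the induction hypothesis.
      have h1 : sphereMoment d 1 (W * W) =
          sphereMoment d 1 (Y * Y) + sphereMoment d 1 ((W - Y) * (W - Y)) := by
        have e : W * W = Y * Y + (Y * (W - Y) + Y * (W - Y)) + (W - Y) * (W - Y) := by ring
        rw [e, map_add, map_add, map_add, h0]; ring
      have h2 := sphereMoment_mul_self_nonneg 1 Y
      have h3 := sphereMoment_mul_self_nonneg 1 (W - Y)
      have h4 := eq_zero_of_sphereMoment_of_xEuler hd hYt hYE (by linarith)
      have h5 := ih (W - Y) hV hVn (by rw [map_sub, ht, hYt, sub_zero]) (by linarith)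
      rw [← sub_add_cancel W Y, h5, h4, add_zero]
  refine key (W.totalDegree + 1) W hW ?_ ht h
  push_cast
  rw [add_sub_cancel_right]
  exact mem_polyLE_natCast.2 le_rfl

/-- A polynomial that is harmonic in `x` and vanishes on the cone is zero. -/
theorem eq_zero_of_forall_sphereMoment {d : ℕ} (hd : 2 ≤ d) {P : MvPolynomial (Fin (d + 1)) ℝ}
    (hP : P ∈ xHarmonic d) (h : ∀ t ∈ Set.Ioo (0 : ℝ) 1, sphereMoment d t (P * P) = 0) :
    P = 0 := by
  have h1 : ∀ t ∈ Set.Ioo (0 : ℝ) 1, coneSlice d t P = 0 := fun t ht =>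
    eq_zero_of_sphereMoment hd (coneSlice_mem_xHarmonic t hP) (pderiv_last_coneSlice t P)
      (by rw [← map_mul, sphereMoment_coneSlice, h t ht])
  -- Each slice with `0 < t < 1` vanishes identically in `x`. This gives zeros on `ℝ^d × (0, 1)`, a
  -- product of infinite sets, which determines a polynomial.
  refine MvPolynomial.funext_set
    (Fin.snoc (α := fun _ => Set ℝ) (fun _ => Set.univ) (Set.Ioo (0 : ℝ) 1)) (fun i => ?_)
    fun y hy => ?_
  · refine Fin.lastCases ?_ (fun j => ?_) i
    · simpa using Set.Ioo_infinite (zero_lt_one (α := ℝ))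
    · simpa using Set.infinite_univ
  · have hy1 : y (Fin.last d) ∈ Set.Ioo (0 : ℝ) 1 := by
      have := hy (Fin.last d) (Set.mem_univ _)
      rwa [Fin.snoc_last] at this
    have h2 := eval_coneSlice (y (Fin.last d)) P
      (fun i => (y (Fin.last d))⁻¹ * y i.castSucc) (y (Fin.last d))
    simp only [mul_inv_cancel_left₀ hy1.1.ne', h1 _ hy1, map_zero] at h2
    rw [map_zero, h2]
    congr 2
    exact (Fin.snoc_init_self (α := fun _ => ℝ) y).symm

/-! ### The Sobolev inner product on harmonic representatives -/

/-- The Sobolev form `∫ ∂P/∂t ∂Q/∂t dm + λ ∫ P(ξ, 1) Q(ξ, 1) dσ(ξ)`. -/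
def sobolevMoment (d : ℕ) (lam : ℝ) (P Q : MvPolynomial (Fin (d + 1)) ℝ) : ℝ :=
  coneMoment d (d - 1) (pderiv (Fin.last d) P * pderiv (Fin.last d) Q) +
    lam * sphereMoment d 1 (P * Q)

theorem sobolevMoment_add_left {d : ℕ} (lam : ℝ) (P P' Q : MvPolynomial (Fin (d + 1)) ℝ) :
    sobolevMoment d lam (P + P') Q = sobolevMoment d lam P Q + sobolevMoment d lam P' Q := by
  simp only [sobolevMoment, map_add, add_mul]; ring

theorem sobolevMoment_smul_left {d : ℕ} (lam c : ℝ) (P Q : MvPolynomial (Fin (d + 1)) ℝ) :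
    sobolevMoment d lam (c • P) Q = c * sobolevMoment d lam P Q := by
  simp only [sobolevMoment, Derivation.map_smul, map_smul, smul_mul_assoc, smul_eq_mul]; ring

theorem sobolevMoment_comm {d : ℕ} (lam : ℝ) (P Q : MvPolynomial (Fin (d + 1)) ℝ) :
    sobolevMoment d lam P Q = sobolevMoment d lam Q P := by
  simp only [sobolevMoment, mul_comm]

/-- Both terms are nonnegative, so both vanish. The first forces `∂ₜW = 0` as a polynomial; then `W`
is free of `t`, and the boundary term, with `lam > 0`, forces `W = 0`. -/
theorem eq_zero_of_sobolevMoment {d : ℕ} (hd : 2 ≤ d) {lam : ℝ} (hlam : 0 < lam)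
    {W : MvPolynomial (Fin (d + 1)) ℝ} (hW : W ∈ xHarmonic d) (h : sobolevMoment d lam W W = 0) :
    W = 0 := by
  have h1 := coneMoment_mul_self_nonneg (d - 1) (pderiv (Fin.last d) W)
  have h2 := sphereMoment_mul_self_nonneg 1 W
  have h3 := mul_nonneg hlam.le h2
  rw [sobolevMoment] at h
  have h4 : sphereMoment d 1 (W * W) = 0 :=
    (mul_eq_zero.1 (by linarith : lam * sphereMoment d 1 (W * W) = 0)).resolve_left hlam.ne'
  have h5 := eq_zero_of_forall_sphereMoment hd (pderiv_last_mem_xHarmonic hW) fun t ht =>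
    sphereMoment_eq_zero_of_coneMoment (k := d - 1) (by linarith) ht
  exact eq_zero_of_sphereMoment hd hW h5 h4

theorem sobolevMoment_xEuler {d : ℕ} (hd : 2 ≤ d) (lam : ℝ) {P Q : MvPolynomial (Fin (d + 1)) ℝ}
    (hP : P ∈ xHarmonic d) (hQ : Q ∈ xHarmonic d) :
    sobolevMoment d lam (xEuler d P) Q = sobolevMoment d lam P (xEuler d Q) := by
  rw [sobolevMoment, sobolevMoment, pderiv_last_xEuler, pderiv_last_xEuler,
    coneMoment_xEuler_mul hd _ (pderiv_last_mem_xHarmonic hP) (pderiv_last_mem_xHarmonic hQ),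
    sphereMoment_xEuler_mul hd _ hP hQ]

/-- The operator `t ∂²/∂t² + (2E + d - 1) ∂/∂t`, where `E` is the Euler operator in `x`. -/
def radialOp (d : ℕ) (P : MvPolynomial (Fin (d + 1)) ℝ) : MvPolynomial (Fin (d + 1)) ℝ :=
  diagOp d (fun a b => 2 * a + b + d - 1) (pderiv (Fin.last d) P)

theorem radialOp_mem_xHarmonic {d : ℕ} {P : MvPolynomial (Fin (d + 1)) ℝ} (h : P ∈ xHarmonic d) :
    radialOp d P ∈ xHarmonic d :=
  diagOp_mem_xHarmonic _ (pderiv_last_mem_xHarmonic h)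

theorem radialOp_mem_polyLE {d : ℕ} {n : ℤ} {P : MvPolynomial (Fin (d + 1)) ℝ}
    (h : P ∈ polyLE d n) : radialOp d P ∈ polyLE d (n - 1) :=
  diagOp_mem_polyLE _ (pderiv_mem_polyLE _ h)

/-- Moving `∂ₜ` to the front shifts `b` by one, which turns `d - 1` into `d - 2`; then `t∂ₜ`
contributes the factor `b`. -/
theorem X_last_mul_radialOp {d : ℕ} (P : MvPolynomial (Fin (d + 1)) ℝ) :
    X (Fin.last d) * radialOp d P = diagOp d (fun a b => b * (2 * a + b + d - 2)) P := by
  have h : radialOp d P = pderiv (Fin.last d) (diagOp d (fun a b => 2 * a + b + d - 2) P) := by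
    rw [pderiv_last_diagOp, radialOp]
    congr 2
    funext a b
    push_cast
    ring
  rw [h, X_last_mul_pderiv_last, diagOp_diagOp]

/-- `L` sends `t^(b+1)` to `(b + 1)(2a + b + d - 1) t^b` on terms of degree `a` in `x`. These
factors are nonzero for `d ≥ 2`, so dividing by them and multiplying by `t` inverts `L` on the
right. -/
theorem exists_radialOp_eq {d : ℕ} (hd : 2 ≤ d) {n : ℤ} {R : MvPolynomial (Fin (d + 1)) ℝ}
    (hR : R ∈ xHarmonic d) (hn : R ∈ polyLE d (n - 1)) :
    ∃ Q ∈ xHarmonic d, Q ∈ polyLE d n ∧ radialOp d Q = R := by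
  refine ⟨X (Fin.last d) * diagOp d (fun a b => ((b + 1) * (2 * a + b + d - 1))⁻¹) R,
    X_last_mul_mem_xHarmonic (diagOp_mem_xHarmonic _ hR), ?_, ?_⟩
  · simpa using X_mul_mem_polyLE (Fin.last d) (diagOp_mem_polyLE _ hn)
  · rw [radialOp, pderiv_last_X_last_mul, diagOp_diagOp, diagOp_diagOp]
    refine diagOp_eq_self fun m _ => ?_
    have h : (2 : ℝ) ≤ d := by exact_mod_cast hd
    have h1 : 0 < 2 * (xDegree m : ℝ) + m (Fin.last d) + d - 1 := by
      have : (0 : ℝ) ≤ 2 * (xDegree m : ℝ) + m (Fin.last d) := by positivity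
      linarith
    have h2 : 0 < (m (Fin.last d) : ℝ) + 1 := by positivity
    field_simp

/-- The fundamental theorem of calculus along rays involves `N = E + t∂ₜ`, not `∂ₜ` alone. The
symmetry of `E` gathers both Euler terms on `P`; this is the origin of the `2a`. -/
theorem coneMoment_mul_pderiv_last {d : ℕ} (hd : 2 ≤ d) {P Q : MvPolynomial (Fin (d + 1)) ℝ}
    (hP : P ∈ xHarmonic d) (hQ : Q ∈ xHarmonic d) :
    coneMoment d (d - 1) (P * pderiv (Fin.last d) Q) = sphereMoment d 1 (P * Q) -
      coneMoment d (d - 2) (diagOp d (fun a b => 2 * a + b + d - 1) P * Q) := by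
  have hc : (((d - 2 : ℕ) : ℝ)) = d - 2 := by rw [Nat.cast_sub hd]; norm_num
  have h1 : diagOp d (fun a b => a + b + (d - 2 : ℕ) + 1) (P * Q) =
      xEuler d P * Q + P * xEuler d Q + X (Fin.last d) * pderiv (Fin.last d) P * Q +
        X (Fin.last d) * (P * pderiv (Fin.last d) Q) + ((d : ℝ) - 1) • (P * Q) := by
    have e : (fun a b : ℕ => (a : ℝ) + b + (d - 2 : ℕ) + 1) =
        fun a b : ℕ => ((a : ℝ) + b) + ((d : ℝ) - 1) := by
      funext a b; rw [hc]; ring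
    rw [e, diagOp_add (fun a b => (a : ℝ) + b) (fun _ _ => (d : ℝ) - 1),
      diagOp_add (fun a _ => (a : ℝ)) (fun _ b => (b : ℝ)), diagOp_const, ← xEuler_eq_diagOp,
      ← X_last_mul_pderiv_last, xEuler_mul, pderiv_mul]
    ring
  have h2 : diagOp d (fun a b => 2 * a + b + d - 1) P =
      (2 : ℝ) • xEuler d P + X (Fin.last d) * pderiv (Fin.last d) P + ((d : ℝ) - 1) • P := by
    rw [X_last_mul_pderiv_last, xEuler_eq_diagOp]
    ext m
    simp only [coeff_add, coeff_smul, coeff_diagOp, smul_eq_mul]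
    ring
  have h3 := coneMoment_diagOp (d - 2) (P * Q)
  rw [h1, map_add, map_add, map_add, map_add, coneMoment_X_last_mul,
    ← coneMoment_xEuler_mul hd _ hP hQ, show d - 2 + 1 = d - 1 by omega] at h3
  rw [h2, add_mul, add_mul, map_add, map_add, smul_mul_assoc, smul_mul_assoc, map_smul,
    smul_eq_mul]
  linarith

/-- Integration by parts throws `∂ₜ` from `(1 - t)P` onto `∂ₜQ` and produces `LQ`. The factor `1 -
t` kills both the boundary term and the `lam` term. This identity links the Sobolev form to the
weight `t⁻¹(1 - t)`. -/
theorem sobolevMoment_one_sub_X_last_mul {d : ℕ} (hd : 2 ≤ d) (lam : ℝ)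
    {P Q : MvPolynomial (Fin (d + 1)) ℝ} (hP : P ∈ xHarmonic d) (hQ : Q ∈ xHarmonic d) :
    sobolevMoment d lam ((1 - X (Fin.last d)) * P) Q =
      -coneMoment d (d - 2) ((1 - X (Fin.last d)) * (P * radialOp d Q)) := by
  rw [sobolevMoment, mul_assoc, sphereMoment_one_one_sub_X_last_mul, mul_comm (pderiv _ _),
    coneMoment_mul_pderiv_last hd (pderiv_last_mem_xHarmonic hQ)
      (one_sub_X_last_mul_mem_xHarmonic_iff.2 hP), mul_left_comm,
    sphereMoment_one_one_sub_X_last_mul, ← radialOp]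
  rw [show radialOp d Q * ((1 - X (Fin.last d)) * P) =
    (1 - X (Fin.last d)) * (P * radialOp d Q) by ring]
  ring

/-! ### The differential operator on harmonic representatives -/

/-- The operator `D_{-1}` on harmonic representatives. -/
def coneOp (d : ℕ) (P : MvPolynomial (Fin (d + 1)) ℝ) : MvPolynomial (Fin (d + 1)) ℝ :=
  (1 - X (Fin.last d)) * radialOp d P - (xEuler d (xEuler d P) + ((d : ℝ) - 2) • xEuler d P)

/-- Rests on `b(2a + b + d - 2) + a(a + d - 2) = (a + b)(a + b + d - 2)`. With `c = n(n + d - 2)`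
the diagonal term vanishes in total degree `n`. -/
theorem coneOp_add_smul {d : ℕ} (c : ℝ) (P : MvPolynomial (Fin (d + 1)) ℝ) :
    coneOp d P + c • P = radialOp d P +
      diagOp d (fun a b => c - ((a : ℝ) + b) * (a + b + d - 2)) P := by
  have h : diagOp d (fun a b => b * (2 * a + b + d - 2)) P +
      (xEuler d (xEuler d P) + ((d : ℝ) - 2) • xEuler d P) +
      diagOp d (fun a b => c - ((a : ℝ) + b) * (a + b + d - 2)) P = c • P := by
    simp only [xEuler_eq_diagOp]
    ext m
    simp only [coeff_add, coeff_smul, coeff_diagOp, smul_eq_mul]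
    ring
  rw [coneOp, sub_mul, one_mul, X_last_mul_radialOp]
  linear_combination -h

theorem coneOp_mem_xHarmonic {d : ℕ} {P : MvPolynomial (Fin (d + 1)) ℝ} (h : P ∈ xHarmonic d) :
    coneOp d P ∈ xHarmonic d :=
  sub_mem (one_sub_X_last_mul_mem_xHarmonic_iff.2 (radialOp_mem_xHarmonic h))
    (add_mem (xEuler_mem_xHarmonic (xEuler_mem_xHarmonic h))
      (Submodule.smul_mem _ _ (xEuler_mem_xHarmonic h)))

theorem sobolevMoment_coneOp {d : ℕ} (hd : 2 ≤ d) (lam : ℝ) {P Q : MvPolynomial (Fin (d + 1)) ℝ}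
    (hP : P ∈ xHarmonic d) (hQ : Q ∈ xHarmonic d) :
    sobolevMoment d lam (coneOp d P) Q = sobolevMoment d lam P (coneOp d Q) := by
  -- The first term is symmetric in `A` and `B`; the other two are handled by the symmetry of `E`.
  have key : ∀ {A B : MvPolynomial (Fin (d + 1)) ℝ}, A ∈ xHarmonic d → B ∈ xHarmonic d →
      sobolevMoment d lam (coneOp d A) B =
      -coneMoment d (d - 2) ((1 - X (Fin.last d)) * (radialOp d A * radialOp d B)) -
        sobolevMoment d lam (xEuler d (xEuler d A)) B -
        ((d : ℝ) - 2) * sobolevMoment d lam (xEuler d A) B := by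
    intro A B hA hB
    rw [← sobolevMoment_one_sub_X_last_mul hd lam (radialOp_mem_xHarmonic hA) hB,
      ← sobolevMoment_smul_left]
    have e : (1 - X (Fin.last d)) * radialOp d A =
        coneOp d A + (xEuler d (xEuler d A) + ((d : ℝ) - 2) • xEuler d A) := by
      rw [coneOp, sub_add_cancel]
    rw [e, sobolevMoment_add_left, sobolevMoment_add_left]
    ring
  rw [key hP hQ, sobolevMoment_comm lam P, key hQ hP, sobolevMoment_xEuler hd lam hP hQ,
    sobolevMoment_xEuler hd lam (xEuler_mem_xHarmonic hP) hQ,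
    sobolevMoment_xEuler hd lam hP (xEuler_mem_xHarmonic hQ), sobolevMoment_comm lam P,
    sobolevMoment_comm lam P, mul_comm (radialOp d P)]

theorem coneOp_eq_of_sobolevMoment {d : ℕ} (hd : 2 ≤ d) {lam : ℝ} (hlam : 0 < lam) {n : ℕ}
    {Z : MvPolynomial (Fin (d + 1)) ℝ} (hZ : Z ∈ xHarmonic d) (hn : Z ∈ polyLE d n)
    (h : ∀ Q ∈ xHarmonic d, Q ∈ polyLE d (n - 1) → sobolevMoment d lam Z Q = 0) :
    coneOp d Z = -((n : ℝ) * (n + d - 2)) • Z := by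
  set c : ℝ := (n : ℝ) * (n + d - 2) with hc
  have hW : ∀ {P : MvPolynomial (Fin (d + 1)) ℝ}, P ∈ xHarmonic d →
      coneOp d P + c • P ∈ xHarmonic d := fun hP =>
    add_mem (coneOp_mem_xHarmonic hP) (Submodule.smul_mem _ _ hP)
  have hWn : coneOp d Z + c • Z ∈ polyLE d (n - 1) := by
    rw [coneOp_add_smul]
    refine add_mem (radialOp_mem_polyLE hn) (diagOp_mem_polyLE_sub_one (fun a b hab => ?_) hn)
    have : (a : ℝ) + b = n := by exact_mod_cast hab
    rw [this, hc, sub_self]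
  set W := coneOp d Z + c • Z with hWdef
  have hW2 : coneOp d W + c • W ∈ polyLE d (n - 1) := by
    rw [coneOp_add_smul]
    exact add_mem (polyLE_mono (by omega) (radialOp_mem_polyLE hWn)) (diagOp_mem_polyLE _ hWn)
  -- By symmetry `⟨W, W⟩ = ⟨Z, (coneOp + c)W⟩`, and `(coneOp + c)W` again has degree at most `n -
  -- 1`.
  have h0 : sobolevMoment d lam W W = 0 := by
    have h1 := h _ (hW (hW hZ)) hW2
    rw [sobolevMoment_comm, sobolevMoment_add_left, sobolevMoment_smul_left,
      sobolevMoment_coneOp hd lam (hW hZ) hZ] at h1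
    nth_rw 2 [hWdef]
    rw [sobolevMoment_comm, sobolevMoment_add_left, sobolevMoment_smul_left, sobolevMoment_comm,
      sobolevMoment_comm lam Z]
    exact h1
  have := eq_zero_of_sobolevMoment hd hlam (hW hZ) h0
  rw [neg_smul]
  exact eq_neg_of_add_eq_zero_left this

/-! ### The decomposition -/

theorem sobolevMoment_solidHarmonic {d : ℕ} (hd : 2 ≤ d) (lam : ℝ) {n : ℕ}
    {Y Q : MvPolynomial (Fin (d + 1)) ℝ} (hY : Y ∈ xHarmonic d) (ht : pderiv (Fin.last d) Y = 0)
    (hE : xEuler d Y = (n : ℝ) • Y) (hQ : Q ∈ xHarmonic d) (hn : Q ∈ polyLE d (n - 1)) :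
    sobolevMoment d lam Y Q = 0 := by
  rw [sobolevMoment, ht, zero_mul, map_zero,
    sphereMoment_mul_eq_zero_of_mem_polyLE hd 1 hY hE hQ hn, mul_zero, add_zero]

theorem exists_decomposition {d : ℕ} (hd : 2 ≤ d) {lam : ℝ} (hlam : 0 < lam) {n : ℕ}
    {Z : MvPolynomial (Fin (d + 1)) ℝ} (hZ : Z ∈ xHarmonic d) (hn : Z ∈ polyLE d n)
    (h : ∀ Q ∈ xHarmonic d, Q ∈ polyLE d (n - 1) → sobolevMoment d lam Z Q = 0) :
    ∃ Y ∈ xHarmonic d, pderiv (Fin.last d) Y = 0 ∧ xEuler d Y = (n : ℝ) • Y ∧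
      ∃ P ∈ xHarmonic d, P ∈ polyLE d (n - 1) ∧ Z = Y + (1 - X (Fin.last d)) * P ∧
        ∀ R ∈ xHarmonic d, R ∈ polyLE d (n - 1 - 1) →
          coneMoment d (d - 2) ((1 - X (Fin.last d)) * (P * R)) = 0 := by
  set V := coneSlice d 1 Z with hVdef
  have hV : V ∈ xHarmonic d := coneSlice_mem_xHarmonic 1 hZ
  have hVt : pderiv (Fin.last d) V = 0 := pderiv_last_coneSlice 1 Z
  have hVn : V ∈ polyLE d n := coneSlice_mem_polyLE 1 hn
  set Y := topComponent d n V with hYdef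
  have hY : Y ∈ xHarmonic d := topComponent_mem_xHarmonic hV
  have hYt : pderiv (Fin.last d) Y = 0 := pderiv_last_topComponent hVt
  have hYE := xEuler_topComponent (n := n) hVt
  have hW : V - Y ∈ xHarmonic d := sub_mem hV hY
  have hWn : V - Y ∈ polyLE d (n - 1) := sub_topComponent_mem_polyLE hVn
  have hWt : pderiv (Fin.last d) (V - Y) = 0 := by rw [map_sub, hVt, hYt, sub_zero]
  -- `V - Y` is itself an admissible test polynomial free of `t`, so only the boundary term
  -- survives: `V` is orthogonal to it on the sphere. So is `Y`, of degree `n`, hence `V - Y` is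
  -- orthogonal to itself.
  have hVY : V - Y = 0 := by
    refine eq_zero_of_sphereMoment hd hW hWt ?_
    have h1 := h _ hW hWn
    rw [sobolevMoment, hWt, mul_zero, map_zero, zero_add, ← sphereMoment_coneSlice, map_mul,
      coneSlice_one_eq_self hWt, ← hVdef] at h1
    have h2 := (mul_eq_zero.1 h1).resolve_left hlam.ne'
    rw [sub_mul, map_sub, h2, sphereMoment_mul_eq_zero_of_mem_polyLE hd 1 hY hYE hW hWn, sub_zero]
  obtain ⟨P, hP⟩ := one_sub_X_last_dvd_sub_coneSlice_one Z
  rw [← hVdef, sub_eq_zero.1 hVY] at hP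
  have hPh : P ∈ xHarmonic d := by
    rw [← one_sub_X_last_mul_mem_xHarmonic_iff, ← hP]; exact sub_mem hZ hY
  have hPn : P ∈ polyLE d (n - 1) := by
    refine mem_polyLE_of_one_sub_X_last_mul ?_
    rw [← hP]; exact sub_mem hn (diagOp_mem_polyLE _ hVn)
  refine ⟨Y, hY, hYt, hYE, P, hPh, hPn, by rw [← hP, add_sub_cancel], fun R hR hRn => ?_⟩
  -- Writing `R = LQ` turns the weighted integral into `-⟨(1 - t)P, Q⟩ = -⟨Z - Y, Q⟩`.
  obtain ⟨Q, hQ, hQn, rfl⟩ := exists_radialOp_eq hd hR hRn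
  have h1 := h Q hQ hQn
  rw [← sub_add_cancel Z Y, hP, sobolevMoment_add_left,
    sobolevMoment_solidHarmonic hd lam hY hYt hYE hQ hQn, add_zero,
    sobolevMoment_one_sub_X_last_mul hd lam hPh hQ] at h1
  exact neg_eq_zero.1 h1

/-! ### The differential operator along the cone -/

theorem hasDerivAt_eval_snoc {d : ℕ} {γ : ℝ → Fin d → ℝ} {γ' : Fin d → ℝ} {s : ℝ}
    (h : ∀ i, HasDerivAt (fun r => γ r i) (γ' i) s) (t : ℝ) (P : MvPolynomial (Fin (d + 1)) ℝ) :
    HasDerivAt (fun r => eval (Fin.snoc (γ r) t : Fin (d + 1) → ℝ) P)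
      (∑ i, γ' i * eval (Fin.snoc (γ s) t : Fin (d + 1) → ℝ) (pderiv i.castSucc P)) s := by
  have h1 := hasDerivAt_eval (γ := fun r => (Fin.snoc (γ r) t : Fin (d + 1) → ℝ))
    (γ' := Fin.snoc (α := fun _ => ℝ) γ' 0) (t := s) (fun i => ?_) P
  · refine h1.congr_deriv ?_
    simp [Fin.sum_univ_castSucc]
  · refine Fin.lastCases ?_ (fun j => ?_) i
    · simpa using hasDerivAt_const s t
    · simpa using h j

/-- The derivative of a polynomial along the rays of the cone. -/
def rayDeriv {d : ℕ} (ξ : UnitSphere d) (P : MvPolynomial (Fin (d + 1)) ℝ) (s : ℝ) : ℝ :=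
  ∑ i, conePoint ξ 1 i * eval (conePoint ξ s) (pderiv i P)

theorem hasDerivAt_eval_conePoint {d : ℕ} (ξ : UnitSphere d) (P : MvPolynomial (Fin (d + 1)) ℝ)
    (s : ℝ) : HasDerivAt (fun s => eval (conePoint ξ s) P) (rayDeriv ξ P s) s := by
  refine hasDerivAt_eval (fun i => ?_) P
  have h : (fun r => conePoint ξ r i) = fun r => r * conePoint ξ 1 i := by
    funext r; rw [conePoint_eq_smul]; rfl
  rw [h]
  simpa using (hasDerivAt_id s).mul_const (conePoint ξ 1 i)

/-- The Euler operator in all the variables `(x, t)`. -/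
def fullEuler (d : ℕ) (P : MvPolynomial (Fin (d + 1)) ℝ) : MvPolynomial (Fin (d + 1)) ℝ :=
  diagOp d (fun a b => a + b) P

theorem mul_rayDeriv {d : ℕ} (ξ : UnitSphere d) (P : MvPolynomial (Fin (d + 1)) ℝ) (s : ℝ) :
    s * rayDeriv ξ P s = eval (conePoint ξ s) (fullEuler d P) := by
  rw [fullEuler, diagOp_add (fun a _ => (a : ℝ)) (fun _ b => (b : ℝ)), ← xEuler_eq_diagOp,
    ← X_last_mul_pderiv_last, rayDeriv, Fin.sum_univ_castSucc, mul_add, xEuler, Finset.mul_sum]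
  simp [conePoint, mul_assoc]

theorem exists_hasDerivAt_rayDeriv {d : ℕ} (ξ : UnitSphere d) (P : MvPolynomial (Fin (d + 1)) ℝ)
    (s : ℝ) : ∃ c, HasDerivAt (rayDeriv ξ P) c s :=
  ⟨_, HasDerivAt.fun_sum fun i _ =>
    (hasDerivAt_eval_conePoint ξ (pderiv i P) s).const_mul (conePoint ξ 1 i)⟩

theorem mul_deriv_eval_conePoint {d : ℕ} (ξ : UnitSphere d) (P : MvPolynomial (Fin (d + 1)) ℝ)
    (t : ℝ) : t * deriv (fun s => eval (conePoint ξ s) P) t =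
      eval (conePoint ξ t) (fullEuler d P) := by
  rw [(hasDerivAt_eval_conePoint ξ P t).deriv, mul_rayDeriv]

/-- Along a ray `s d/ds` acts as `N`, so differentiating `s f'` gives `t² f'' = N(N - 1)`. -/
theorem sq_mul_iteratedDeriv_eval_conePoint {d : ℕ} (ξ : UnitSphere d)
    (P : MvPolynomial (Fin (d + 1)) ℝ) (t : ℝ) :
    t ^ 2 * iteratedDeriv 2 (fun s => eval (conePoint ξ s) P) t =
      eval (conePoint ξ t) (fullEuler d (fullEuler d P) - fullEuler d P) := by
  have h1 : deriv (fun s => eval (conePoint ξ s) P) = rayDeriv ξ P :=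
    funext fun s => (hasDerivAt_eval_conePoint ξ P s).deriv
  obtain ⟨c, hc⟩ := exists_hasDerivAt_rayDeriv ξ P t
  have h2 : HasDerivAt (fun s => eval (conePoint ξ s) (fullEuler d P))
      (1 * rayDeriv ξ P t + t * c) t := by
    refine ((hasDerivAt_id t).mul hc).congr_of_eventuallyEq (Filter.Eventually.of_forall fun s => ?_)
    exact (mul_rayDeriv ξ P s).symm
  rw [iteratedDeriv_succ, iteratedDeriv_one, h1, hc.deriv, map_sub, ← mul_deriv_eval_conePoint,
    h2.deriv, ← mul_rayDeriv]
  ring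

/-! ### The Laplace–Beltrami operator on harmonic polynomials -/

/-- Reduces a diagonal entry of the Hessian to a second derivative of one variable along the line `x
+ r v`. -/
theorem fderiv_fderiv_eq_of_hasDerivAt {E : Type*} [NormedAddCommGroup E] [NormedSpace ℝ E]
    {G : E → ℝ} {x v : E} (hG : ContDiffAt ℝ 2 G x) {g : ℝ → ℝ} {c : ℝ}
    (h1 : ∀ᶠ s in nhds (0 : ℝ), HasDerivAt (fun r : ℝ => G (x + r • v)) (g s) s)
    (h2 : HasDerivAt g c 0) : fderiv ℝ (fderiv ℝ G) x v v = c := by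
  let p : ℝ → E := fun r => x + r • v
  have hline : ∀ s : ℝ, HasDerivAt p v s := fun s => by
    simpa [p] using ((hasDerivAt_id s).smul_const v).const_add x
  have hp0 : p 0 = x := by simp [p]
  have hd : ∀ᶠ y in nhds x, DifferentiableAt ℝ G y :=
    (hG.eventually (by simp)).mono fun y hy => hy.differentiableAt (by norm_num)
  have ht : Filter.Tendsto p (nhds 0) (nhds x) := by
    simpa only [hp0] using (hline 0).continuousAt.tendsto
  have he : g =ᶠ[nhds 0] fun s => fderiv ℝ G (p s) v := by
    filter_upwards [h1, ht.eventually hd] with s hs hs'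
    exact hs.unique (HasFDerivAt.comp_hasDerivAt (f := p) s hs'.hasFDerivAt (hline s))
  have hf : HasFDerivAt (fderiv ℝ G) (fderiv ℝ (fderiv ℝ G) x) (p 0) := by
    rw [hp0]
    exact ((hG.fderiv_right (m := 1) (by norm_num)).differentiableAt (by norm_num)).hasFDerivAt
  have h3 : HasDerivAt (fun s => fderiv ℝ G (p s)) (fderiv ℝ (fderiv ℝ G) x v) 0 :=
    HasFDerivAt.comp_hasDerivAt (f := p) 0 hf (hline 0)
  have h4 : HasDerivAt (fun s => fderiv ℝ G (p s) v) (fderiv ℝ (fderiv ℝ G) x v v) 0 :=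
    ((ContinuousLinearMap.apply ℝ ℝ v).hasFDerivAt).comp_hasDerivAt 0 h3
  exact (h4.congr_of_eventuallyEq he).unique h2

/-- The function `y ↦ P(t y / ‖y‖, t)`. -/
def sphereExtension {d : ℕ} (t : ℝ) (P : MvPolynomial (Fin (d + 1)) ℝ)
    (y : EuclideanSpace ℝ (Fin d)) : ℝ :=
  eval (Fin.snoc (fun j => t * (‖y‖⁻¹ * y j)) t : Fin (d + 1) → ℝ) P

theorem radialExtension_eventuallyEq {d : ℕ} (t : ℝ) (P : MvPolynomial (Fin (d + 1)) ℝ)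
    {x : EuclideanSpace ℝ (Fin d)} (hx : x ≠ 0) :
    radialExtension (fun η : UnitSphere d => eval (conePoint η t) P) =ᶠ[nhds x]
      sphereExtension t P := by
  filter_upwards [isOpen_ne.mem_nhds hx] with y hy
  rw [radialExtension, dif_neg hy]
  rfl

theorem contDiffAt_sphereExtension {d : ℕ} (t : ℝ) (P : MvPolynomial (Fin (d + 1)) ℝ)
    {x : EuclideanSpace ℝ (Fin d)} (hx : x ≠ 0) : ContDiffAt ℝ 2 (sphereExtension t P) x := by
  have hc : ∀ j : Fin (d + 1), ContDiffAt ℝ 2 (fun y : EuclideanSpace ℝ (Fin d) =>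
      (Fin.snoc (fun j => t * (‖y‖⁻¹ * y j)) t : Fin (d + 1) → ℝ) j) x := fun j => by
    refine Fin.lastCases ?_ (fun j => ?_) j
    · simpa using contDiffAt_const
    · simp only [Fin.snoc_castSucc]
      have h1 : ContDiffAt ℝ 2 (fun y : EuclideanSpace ℝ (Fin d) => y j) x := by fun_prop
      exact contDiffAt_const.mul (((contDiffAt_norm ℝ hx).inv (norm_ne_zero_iff.2 hx)).mul h1)
  induction P using MvPolynomial.induction_on with
  | C a =>
    have h : sphereExtension t (C a : MvPolynomial (Fin (d + 1)) ℝ) = fun _ => a := by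
      funext y; simp [sphereExtension]
    rw [h]
    exact contDiffAt_const
  | add p q hp hq =>
    have h : sphereExtension t (p + q) = fun y => sphereExtension t p y + sphereExtension t q y := by
      funext y; simp [sphereExtension]
    rw [h]
    exact hp.add hq
  | mul_X p j hp =>
    have h : sphereExtension t (p * X j) = fun y => sphereExtension t p y *
        (Fin.snoc (fun j => t * (‖y‖⁻¹ * y j)) t : Fin (d + 1) → ℝ) j := by
      funext y; simp [sphereExtension]
    rw [h]
    exact hp.mul (hc j)

theorem hasDerivAt_inv_norm_add_smul_single {d : ℕ} (x : EuclideanSpace ℝ (Fin d)) (i : Fin d)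
    {s : ℝ} (hs : x + s • EuclideanSpace.single i (1 : ℝ) ≠ 0) :
    HasDerivAt (fun r : ℝ => ‖x + r • EuclideanSpace.single i (1 : ℝ)‖⁻¹)
      (-(‖x + s • EuclideanSpace.single i (1 : ℝ)‖⁻¹ ^ 3 * (x i + s))) s := by
  have hline : HasDerivAt (fun r : ℝ => x + r • EuclideanSpace.single i (1 : ℝ))
      (EuclideanSpace.single i (1 : ℝ)) s := by
    simpa using ((hasDerivAt_id s).smul_const (EuclideanSpace.single i (1 : ℝ))).const_add x
  have h1 := hline.norm_sq.sqrt (by simpa using hs)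
  have h2 : HasDerivAt (fun r : ℝ => ‖x + r • EuclideanSpace.single i (1 : ℝ)‖)
      ((x i + s) / ‖x + s • EuclideanSpace.single i (1 : ℝ)‖) s := by
    simp only [Real.sqrt_sq (norm_nonneg _)] at h1
    refine h1.congr_deriv ?_
    rw [EuclideanSpace.inner_single_right]
    simp [mul_div_mul_left]
  refine (h2.inv (norm_ne_zero_iff.2 hs)).congr_deriv ?_
  field_simp

/-- Along `ξ + r eᵢ` the inverse norm `u` has `u(0) = 1`, `u'(0) = -ξᵢ` and `u''(0) = 3ξᵢ² - 1`. The
coefficients are the second and first derivatives at `0` of `t u(r)(ξⱼ + r δᵢⱼ)`. -/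
theorem fderiv_fderiv_sphereExtension {d : ℕ} (t : ℝ) (P : MvPolynomial (Fin (d + 1)) ℝ)
    (ξ : UnitSphere d) (i : Fin d) :
    fderiv ℝ (fderiv ℝ (sphereExtension t P)) ξ.1 (EuclideanSpace.single i 1)
        (EuclideanSpace.single i 1) =
      ∑ j : Fin d, (t * ((3 * ξ.1 i ^ 2 - 1) * ξ.1 j - 2 * ξ.1 i * (if j = i then 1 else 0)) *
          eval (conePoint ξ t) (pderiv j.castSucc P) +
        t * ((if j = i then 1 else 0) - ξ.1 i * ξ.1 j) * ∑ l : Fin d,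
          t * ((if l = i then 1 else 0) - ξ.1 i * ξ.1 l) *
            eval (conePoint ξ t) (pderiv l.castSucc (pderiv j.castSucc P))) := by
  have hξ : ‖ξ.1‖ = 1 := norm_eq_of_mem_sphere ξ
  have hξ0 : ξ.1 ≠ 0 := norm_ne_zero_iff.1 (by rw [hξ]; exact one_ne_zero)
  set v : EuclideanSpace ℝ (Fin d) := EuclideanSpace.single i 1 with hv
  set δ : Fin d → ℝ := fun j => if j = i then 1 else 0 with hδ
  have hcoord : ∀ (r : ℝ) (j : Fin d), (ξ.1 + r • v) j = ξ.1 j + r * δ j := fun r j => by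
    simp [hv, hδ, PiLp.single_apply]
  let u : ℝ → ℝ := fun r => ‖ξ.1 + r • v‖⁻¹
  have hu0 : u 0 = 1 := by simp [u, hξ]
  let x : ℝ → Fin d → ℝ := fun r j => t * (u r * (ξ.1 j + r * δ j))
  let x' : ℝ → Fin d → ℝ := fun r j =>
    t * (-(u r ^ 3 * (ξ.1 i + r)) * (ξ.1 j + r * δ j) + u r * δ j)
  have hG : ∀ Q : MvPolynomial (Fin (d + 1)) ℝ, ∀ r : ℝ, sphereExtension t Q (ξ.1 + r • v) =
      eval (Fin.snoc (x r) t : Fin (d + 1) → ℝ) Q := fun Q r => by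
    simp only [sphereExtension, hcoord]; rfl
  have hx0 : (Fin.snoc (x 0) t : Fin (d + 1) → ℝ) = conePoint ξ t := by
    simp [x, hu0, conePoint]
  have hne : ∀ᶠ r in nhds (0 : ℝ), ξ.1 + r • v ≠ 0 := by
    have hc : Continuous fun r : ℝ => ξ.1 + r • v := by fun_prop
    exact hc.continuousAt.eventually_ne (by simpa using hξ0)
  have hlin : ∀ (j : Fin d) (s : ℝ), HasDerivAt (fun r : ℝ => ξ.1 j + r * δ j) (δ j) s :=
    fun j s => by simpa using ((hasDerivAt_id s).mul_const (δ j)).const_add (ξ.1 j)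
  have hx : ∀ s : ℝ, ξ.1 + s • v ≠ 0 → ∀ j, HasDerivAt (fun r => x r j) (x' s j) s :=
    fun s hs j => ((hasDerivAt_inv_norm_add_smul_single ξ.1 i hs).mul (hlin j s)).const_mul t
  have hs0 : ξ.1 + (0 : ℝ) • v ≠ 0 := by simpa using hξ0
  have hu : HasDerivAt u (-ξ.1 i) 0 := by
    refine (hasDerivAt_inv_norm_add_smul_single ξ.1 i hs0).congr_deriv ?_
    change -(u 0 ^ 3 * _) = _
    rw [hu0]; ring
  have hx'' : ∀ j, HasDerivAt (fun r => x' r j)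
      (t * ((3 * ξ.1 i ^ 2 - 1) * ξ.1 j - 2 * ξ.1 i * δ j)) 0 := fun j => by
    have h1 : HasDerivAt (fun r : ℝ => ξ.1 i + r) 1 0 := (hasDerivAt_id 0).const_add (ξ.1 i)
    refine ((((((hu.pow 3).mul h1).neg).mul (hlin j 0)).add (hu.mul_const (δ j))).const_mul
      t).congr_deriv ?_
    simp [hu0]
    left
    ring
  refine fderiv_fderiv_eq_of_hasDerivAt (contDiffAt_sphereExtension t P hξ0)
    (g := fun s => ∑ j, x' s j * eval (Fin.snoc (x s) t : Fin (d + 1) → ℝ)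
      (pderiv j.castSucc P)) ?_ ?_
  · filter_upwards [hne] with s hs
    simp only [hG]
    exact hasDerivAt_eval_snoc (hx s hs) t P
  · have h := HasDerivAt.fun_sum (u := Finset.univ) fun (j : Fin d) _ => (hx'' j).mul
      (hasDerivAt_eval_snoc (hx 0 hs0) t (pderiv j.castSucc P))
    refine h.congr_deriv (Finset.sum_congr rfl fun j _ => ?_)
    have hx'0 : ∀ j, x' 0 j = t * (δ j - ξ.1 i * ξ.1 j) := fun j => by
      simp [x', hu0]; left; ring
    rw [hx0]
    simp only [hx'0, hδ]

theorem eval_xEuler_conePoint {d : ℕ} (ξ : UnitSphere d) (t : ℝ)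
    (P : MvPolynomial (Fin (d + 1)) ℝ) : eval (conePoint ξ t) (xEuler d P) =
      ∑ j : Fin d, t * ξ.1 j * eval (conePoint ξ t) (pderiv j.castSucc P) := by
  simp [xEuler, conePoint]

/-- On harmonic polynomials the Laplace–Beltrami operator is `-E (E + d - 2)`. -/
theorem laplaceBeltrami_eval {d : ℕ} (ξ : UnitSphere d) (t : ℝ)
    {P : MvPolynomial (Fin (d + 1)) ℝ} (hP : P ∈ xHarmonic d) :
    laplaceBeltrami (fun η : UnitSphere d => eval (conePoint η t) P) ξ =
      -eval (conePoint ξ t) (xEuler d (xEuler d P) + ((d : ℝ) - 2) • xEuler d P) := by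
  have hξ : ∑ i, ξ.1 i ^ 2 = 1 := by
    rw [← EuclideanSpace.real_norm_sq_eq, norm_eq_of_mem_sphere ξ, one_pow]
  have hξ0 : ξ.1 ≠ 0 := norm_ne_zero_iff.1 (by rw [norm_eq_of_mem_sphere ξ]; exact one_ne_zero)
  have hH : ∑ j : Fin d, eval (conePoint ξ t) (pderiv j.castSucc (pderiv j.castSucc P)) = 0 := by
    rw [← map_sum, ← xLaplacian_apply, LinearMap.mem_ker.1 hP, map_zero]
  rw [laplaceBeltrami,
    (InnerProductSpace.laplacian_congr_nhds (radialExtension_eventuallyEq t P hξ0)).eq_of_nhds,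
    InnerProductSpace.laplacian_eq_iteratedFDeriv_orthonormalBasis _
      (EuclideanSpace.basisFun (Fin d) ℝ)]
  simp only [iteratedFDeriv_two_apply, EuclideanSpace.basisFun_apply, Matrix.cons_val_zero,
    Matrix.cons_val_one, fderiv_fderiv_sphereExtension]
  set D : Fin d → ℝ := fun j => eval (conePoint ξ t) (pderiv j.castSucc P) with hD
  set H : Fin d → Fin d → ℝ := fun j l =>
    eval (conePoint ξ t) (pderiv l.castSucc (pderiv j.castSucc P)) with hHdef
  have hE : eval (conePoint ξ t) (xEuler d P) = ∑ j, t * ξ.1 j * D j :=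
    eval_xEuler_conePoint ξ t P
  have hEE : eval (conePoint ξ t) (xEuler d (xEuler d P)) =
      ∑ j, t * ξ.1 j * D j + ∑ j, ∑ l, t ^ 2 * (ξ.1 j * ξ.1 l) * H j l := by
    rw [eval_xEuler_conePoint, Finset.sum_comm, ← Finset.sum_add_distrib]
    refine Finset.sum_congr rfl fun l _ => ?_
    have h1 : pderiv l.castSucc (xEuler d P) = pderiv l.castSucc P +
        ∑ j : Fin d, X j.castSucc * pderiv l.castSucc (pderiv j.castSucc P) := by
      classical
      have h2 : ∀ j : Fin d, pderiv l.castSucc (X j.castSucc * pderiv j.castSucc P) =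
          (if j = l then pderiv l.castSucc P else 0) +
            X j.castSucc * pderiv l.castSucc (pderiv j.castSucc P) := fun j => by
        rw [pderiv_mul]
        split_ifs with h
        · subst h; simp
        · rw [pderiv_X_of_ne (by simpa using h), zero_mul]
      rw [xEuler, map_sum]
      simp only [h2, Finset.sum_add_distrib, Finset.sum_ite_eq', Finset.mem_univ, if_true]
    rw [h1, map_add, map_sum, mul_add, Finset.mul_sum]
    congr 1
    refine Finset.sum_congr rfl fun j _ => ?_
    simp [hHdef, conePoint]
    ring
  -- Since `‖ξ‖ = 1`, the sum over `i` gives `(3 - d)ξⱼ - 2ξⱼ = (1 - d)ξⱼ`.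
  have hA : ∀ j : Fin d, ∑ i, t * ((3 * ξ.1 i ^ 2 - 1) * ξ.1 j - 2 * ξ.1 i *
      (if j = i then 1 else 0)) * D j = (1 - d) * (t * ξ.1 j * D j) := fun j => by
    rw [← Finset.sum_mul, ← Finset.mul_sum, Finset.sum_sub_distrib, ← Finset.sum_mul,
      Finset.sum_sub_distrib, ← Finset.mul_sum, hξ]
    simp
    ring
  -- The matrix `δ - ξξᵀ` is the projection to the tangent space, so its square is itself. The part
  -- with `δ` gives the trace of the Hessian, zero by harmonicity; the rest gives `-(E² - E)`.
  have hB : ∀ j l : Fin d, ∑ i, t * ((if j = i then 1 else 0) - ξ.1 i * ξ.1 j) *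
      (t * ((if l = i then 1 else 0) - ξ.1 i * ξ.1 l) * H j l) =
      (if j = l then t ^ 2 * H j l else 0) - t ^ 2 * (ξ.1 j * ξ.1 l) * H j l := fun j l => by
    have h1 : ∀ i, t * ((if j = i then 1 else 0) - ξ.1 i * ξ.1 j) *
        (t * ((if l = i then 1 else 0) - ξ.1 i * ξ.1 l) * H j l) =
        t ^ 2 * H j l * ((if j = i then (if l = i then 1 else 0) else 0) -
          (if j = i then ξ.1 i * ξ.1 l else 0) - (if l = i then ξ.1 i * ξ.1 j else 0) +
          ξ.1 i ^ 2 * (ξ.1 j * ξ.1 l)) := fun i => by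
      split_ifs <;> ring
    simp only [h1]
    rw [← Finset.mul_sum, Finset.sum_add_distrib, Finset.sum_sub_distrib, Finset.sum_sub_distrib,
      ← Finset.sum_mul, hξ]
    simp only [Finset.sum_ite_eq, Finset.mem_univ, if_true, eq_comm (a := l) (b := j)]
    split_ifs <;> ring
  have hAB : ∀ j : Fin d, ∑ i, (t * ((3 * ξ.1 i ^ 2 - 1) * ξ.1 j - 2 * ξ.1 i *
      (if j = i then 1 else 0)) * D j + t * ((if j = i then 1 else 0) - ξ.1 i * ξ.1 j) *
        ∑ l, t * ((if l = i then 1 else 0) - ξ.1 i * ξ.1 l) * H j l) =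
      (1 - d) * (t * ξ.1 j * D j) + (t ^ 2 * H j j - ∑ l, t ^ 2 * (ξ.1 j * ξ.1 l) * H j l) :=
    fun j => by
      rw [Finset.sum_add_distrib, hA]
      congr 1
      simp only [Finset.mul_sum]
      rw [Finset.sum_comm]
      simp only [hB, Finset.sum_sub_distrib, Finset.sum_ite_eq, Finset.mem_univ, if_true]
  rw [Finset.sum_comm, map_add, hEE, smul_eval, hE]
  refine (Finset.sum_congr rfl fun j _ => hAB j).trans ?_
  rw [Finset.sum_add_distrib, Finset.sum_sub_distrib, ← Finset.mul_sum, ← Finset.mul_sum, hH]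
  ring

theorem coneOperator_coneMk {d : ℕ} {P : MvPolynomial (Fin (d + 1)) ℝ} (hP : P ∈ xHarmonic d)
    (ξ : UnitSphere d) {t : ℝ} (ht : t ≠ 0) :
    coneOperator d (-1) (fun η s => coneVal η s (coneMk d P)) ξ t =
      coneVal ξ t (coneMk d (coneOp d P)) := by
  simp only [coneOperator, coneVal_coneMk_eq_eval, laplaceBeltrami_eval ξ t hP]
  have h1 := mul_deriv_eval_conePoint ξ P t
  have h2 := sq_mul_iteratedDeriv_eval_conePoint ξ P t
  have h3 : X (Fin.last d) * radialOp d P = (fullEuler d (fullEuler d P) - fullEuler d P) +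
      ((d : ℝ) - 1) • fullEuler d P - (xEuler d (xEuler d P) + ((d : ℝ) - 2) • xEuler d P) := by
    rw [X_last_mul_radialOp]
    simp only [xEuler_eq_diagOp, fullEuler]
    ext m
    simp only [coeff_add, coeff_sub, coeff_smul, coeff_diagOp, smul_eq_mul]
    ring
  have h4 := congrArg (eval (conePoint ξ t)) h3
  rw [map_mul, eval_conePoint_X_last, map_sub, map_add, ← h2, smul_eval, ← h1] at h4
  rw [coneOp, map_sub, map_mul, map_sub, map_one, eval_conePoint_X_last]
  set f' := deriv (fun s => eval (conePoint ξ s) P) t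
  set f'' := iteratedDeriv 2 (fun s => eval (conePoint ξ s) P) t
  set e := eval (conePoint ξ t) (xEuler d (xEuler d P) + ((d : ℝ) - 2) • xEuler d P)
  set m := eval (conePoint ξ t) (radialOp d P)
  -- With `e` the value of `E(E + d - 2)P`, this is `tL = N(N - 1) + (d - 1)N - E(E + d - 2)`
  -- divided by `t`. In `(1 - t)m - e` the terms `+e` and `-e` cancel, which leaves `t⁻¹Δ₀`.
  have h5 : m = t * f'' + ((d : ℝ) - 1) * f' - t⁻¹ * e := by
    field_simp
    linear_combination h4
  rw [h5]
  field_simp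
  ring

/-! ### The main theorem -/

theorem mem_orthPoly_iff {d : ℕ} {B : LinearMap.BilinForm ℝ (ConePoly d)} {n : ℤ}
    {u : ConePoly d} : u ∈ orthPoly B n ↔
      u ∈ conePolyLE d n ∧ ∀ v ∈ conePolyLE d (n - 1), B v u = 0 :=
  Iff.rfl

/-- It suffices to test against harmonic `Q` because harmonic representatives respect the degree
bound. -/
theorem coneMk_mem_sobolevSpace_iff {d : ℕ} (hd : 2 ≤ d) (h1 : -(d : ℝ) < -1 + 1) (lam : ℝ) {n : ℤ}
    {P : MvPolynomial (Fin (d + 1)) ℝ} (hP : P ∈ xHarmonic d) (hn : P ∈ polyLE d n) :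
    coneMk d P ∈ sobolevSpace hd (-1) h1 lam n ↔
      ∀ Q ∈ xHarmonic d, Q ∈ polyLE d (n - 1) → sobolevMoment d lam P Q = 0 := by
  have key : ∀ Q ∈ xHarmonic d, sobolevInner hd (-1) h1 lam (coneMk d Q) (coneMk d P) = 0 ↔
      sobolevMoment d lam P Q = 0 := fun Q hQ => by
    rw [sobolevInner_coneMk hd h1 lam hQ hP, ← sobolevMoment, sobolevMoment_comm]
    simp [(sphereArea_pos hd).ne']
  rw [sobolevSpace, mem_orthPoly_iff]
  constructor
  · rintro ⟨-, h⟩ Q hQ hQn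
    exact (key Q hQ).1 (h _ (coneMk_mem_conePolyLE hQn))
  · refine fun h => ⟨coneMk_mem_conePolyLE hn, fun v hv => ?_⟩
    obtain ⟨Q, hQ, hQn, rfl⟩ := exists_xHarmonic_of_mem_conePolyLE hd hv
    exact (key Q hQ).2 (h Q hQ hQn)

theorem coneMk_mem_jacobiSpace_iff {d : ℕ} (hd : 2 ≤ d) (h1 : -(d : ℝ) < -1) (h2 : -1 < (1 : ℝ))
    {n : ℤ} {P : MvPolynomial (Fin (d + 1)) ℝ} (hn : P ∈ polyLE d n) :
    coneMk d P ∈ jacobiSpace hd (-1) 1 h1 h2 n ↔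
      ∀ Q ∈ xHarmonic d, Q ∈ polyLE d (n - 1) →
        coneMoment d (d - 2) ((1 - X (Fin.last d)) * (P * Q)) = 0 := by
  have key : ∀ Q, jacobiInner hd (-1) 1 h1 h2 (coneMk d Q) (coneMk d P) = 0 ↔
      coneMoment d (d - 2) ((1 - X (Fin.last d)) * (P * Q)) = 0 := fun Q => by
    rw [jacobiInner_coneMk hd h1 h2, mul_comm Q]
    simp [(coneNorm_neg_one_one_pos hd).ne']
  rw [jacobiSpace, mem_orthPoly_iff]
  constructor
  · rintro ⟨-, h⟩ Q hQ hQn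
    exact (key Q).1 (h _ (coneMk_mem_conePolyLE hQn))
  · refine fun h => ⟨coneMk_mem_conePolyLE hn, fun v hv => ?_⟩
    obtain ⟨Q, hQ, hQn, rfl⟩ := exists_xHarmonic_of_mem_conePolyLE hd hv
    exact (key Q).2 (h Q hQ hQn)

theorem mem_polyLE_of_xEuler_eq {d n : ℕ} {Y : MvPolynomial (Fin (d + 1)) ℝ}
    (ht : pderiv (Fin.last d) Y = 0) (hE : xEuler d Y = (n : ℝ) • Y) : Y ∈ polyLE d n :=
  mem_polyLE.2 fun m hm => by
    rw [degree_eq_xDegree_add, xDegree_eq_of_xEuler_eq hE hm,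
      coeff_eq_zero_of_pderiv_last_eq_zero ht hm, add_zero]

theorem mulLeft_one_sub_coneT_coneMk {d : ℕ} (P : MvPolynomial (Fin (d + 1)) ℝ) :
    LinearMap.mulLeft ℝ (1 - coneT d) (coneMk d P) = coneMk d ((1 - X (Fin.last d)) * P) := by
  rw [LinearMap.mulLeft_apply, map_mul, map_sub, map_one, coneT]

theorem mainTheorem3 (d : ℕ) (hd : 2 ≤ d) (lam : ℝ) (hlam : 0 < lam) (n : ℕ) :
    (∀ Z ∈ sobolevSpace hd (-1) (neg_natCast_lt_neg_one_add_one hd) lam n,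
      ∀ (ξ : UnitSphere d), ∀ t ∈ Set.Ioc (0 : ℝ) 1,
        coneOperator d (-1) (fun η s => coneVal η s Z) ξ t =
          -((n : ℝ) * (n + d - 2)) * coneVal ξ t Z) ∧
    (sobolevSpace hd (-1) (neg_natCast_lt_neg_one_add_one hd) lam n =
      coneSolidHarmonic d n ⊔
        (jacobiSpace hd (-1) 1 (neg_natCast_lt_neg_one hd) (by norm_num) (n - 1)).map
          (LinearMap.mulLeft ℝ (1 - coneT d)) ∧
    Disjoint (coneSolidHarmonic d n)
      ((jacobiSpace hd (-1) 1 (neg_natCast_lt_neg_one hd) (by norm_num) (n - 1)).map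
          (LinearMap.mulLeft ℝ (1 - coneT d)))) := by
  have hS : ∀ Z ∈ sobolevSpace hd (-1) (neg_natCast_lt_neg_one_add_one hd) lam n,
      ∃ P ∈ xHarmonic d, P ∈ polyLE d n ∧ coneMk d P = Z ∧
        ∀ Q ∈ xHarmonic d, Q ∈ polyLE d (n - 1) → sobolevMoment d lam P Q = 0 := fun Z hZ => by
    obtain ⟨P, hP, hPn, rfl⟩ := exists_xHarmonic_of_mem_conePolyLE hd hZ.1
    exact ⟨P, hP, hPn, rfl, (coneMk_mem_sobolevSpace_iff hd _ lam hP hPn).1 hZ⟩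
  refine ⟨fun Z hZ ξ t ht => ?_, le_antisymm (fun Z hZ => ?_) (sup_le ?_ ?_), ?_⟩
  · obtain ⟨P, hP, hPn, rfl, h⟩ := hS Z hZ
    rw [coneOperator_coneMk hP ξ ht.1.ne', coneOp_eq_of_sobolevMoment hd hlam hP hPn h, map_smul,
      map_smul, smul_eq_mul]
  · obtain ⟨P, hP, hPn, rfl, h⟩ := hS Z hZ
    obtain ⟨Y, hY, hYt, hYE, R, -, hRn, rfl, hRo⟩ := exists_decomposition hd hlam hP hPn h
    rw [map_add, ← mulLeft_one_sub_coneT_coneMk]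
    exact Submodule.add_mem_sup (mem_coneSolidHarmonic_iff.2 ⟨Y, hY, hYt, hYE, rfl⟩)
      (Submodule.mem_map_of_mem ((coneMk_mem_jacobiSpace_iff hd _ _ hRn).2 hRo))
  · intro u hu
    obtain ⟨Y, hY, hYt, hYE, rfl⟩ := mem_coneSolidHarmonic_iff.1 hu
    exact (coneMk_mem_sobolevSpace_iff hd _ lam hY (mem_polyLE_of_xEuler_eq hYt hYE)).2
      fun Q hQ hQn => sobolevMoment_solidHarmonic hd lam hY hYt hYE hQ hQn
  · rintro _ ⟨u, hu, rfl⟩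
    obtain ⟨P, hP, hPn, rfl⟩ := exists_xHarmonic_of_mem_conePolyLE hd hu.1
    rw [mulLeft_one_sub_coneT_coneMk]
    refine (coneMk_mem_sobolevSpace_iff hd _ lam (one_sub_X_last_mul_mem_xHarmonic_iff.2 hP)
      (one_sub_X_last_mul_mem_polyLE hPn)).2 fun Q hQ hQn => ?_
    -- `LQ` has degree at most `n - 2`, exactly the range to which `P` is orthogonal.
    rw [sobolevMoment_one_sub_X_last_mul hd lam hP hQ,
      (coneMk_mem_jacobiSpace_iff hd _ _ hPn).1 hu _ (radialOp_mem_xHarmonic hQ)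
        (radialOp_mem_polyLE hQn), neg_zero]
  · rw [Submodule.disjoint_def]
    rintro _ hu ⟨v, hv, rfl⟩
    obtain ⟨Y, hY, hYt, -, h⟩ := mem_coneSolidHarmonic_iff.1 hu
    obtain ⟨P, hP, -, rfl⟩ := exists_xHarmonic_of_mem_conePolyLE hd hv.1
    rw [mulLeft_one_sub_coneT_coneMk] at h ⊢
    have hYP := eq_of_coneMk_eq hd hY (one_sub_X_last_mul_mem_xHarmonic_iff.2 hP) h
    -- At `t = 1` the product `(1 - t)P` vanishes, while `Y` is unchanged because it is free of `t`.
    have h0 : Y = 0 := by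
      rw [← coneSlice_one_eq_self hYt, hYP, map_mul, map_sub, map_one, coneSlice_X_last, map_one,
        sub_self, zero_mul]
    rw [← hYP, h0, map_zero]

end
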